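/- Let $n\ge 1$. For a finite field $\mathbb F_q$ of odd characteristic and $d\ge 0$, let $\mathscr X$ be the set of flags $0=V_0\subseteq V_1\subseteq\dots\subseteq V_n=\mathbb F_q^d$. The $GL_d(\mathbb F_q)$-orbits $\mathcal O_A$ on $\mathscr X\times\mathscr X$ are labelled by the set $\Theta_d$ of $n\times n$ matrices $A$ over $\mathbb N$ with sum of entries $d$; the orbit of $(V,V')$ has matrix entries $a_{ij}=\dim\frac{V_{i-1}+V_i\cap V'_j}{V_{i-1}+V_i\cap V'_{j-1}}$. Let $\mathcal S_d$ be the generic Schur algebra over $\mathbb Q(v)$: it has basis $e_A$ $(A\in\Theta_d)$ and product $e_A*e_B=\sum_C g_{A,B}^C(v^2)\,e_C$, where $g_{A,B}^C\in\mathbb Z[x]$ is the polynomial such that, for every such $q$ and every $(V,V')\in\mathcal O_C$, $g_{A,B}^C(q)=\#\{V''\in\mathscr X : (V,V'')\in\mathcal O_A,\ (V'',V')\in\mathcal O_B\}$. Put $[A]=v^{-(d(A)-r(A))}e_A$ with $d(A)=\dim\mathcal O_A=\sum_{i<k\text{ or }j<l}a_{ij}a_{kl}$ and $r(A)=d(B)$,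 where $B$ is the diagonal matrix with $b_{ii}=\sum_k a_{ik}$. Let $\widetilde\Theta$ be the set of integer $n\times n$ matrices with nonnegative off-diagonal entries, and let $\mathrm{ro}(A),\mathrm{co}(A)\in\mathbb Z^n$ be the vectors of row and column sums of $A\in\widetilde\Theta$. For $A,B\in\widetilde\Theta$ with $\mathrm{co}(A)=\mathrm{ro}(B)$ set $[A]\cdot[B]=\sum_Z G_Z(v,1)[Z]$, where $(G_Z)_{Z\in\widetilde\Theta}$ is the finitely supported family in $\mathbb Q(v)[v']$ with $[A+pI]*[B+pI]=\sum_Z G_Z(v,v^{-p})[Z+pI]$ in $\mathcal S_d$, $d$ being the sum of the entries of $A+pI$, for all large $p$; set $[A]\cdot[B]=0$ if $\mathrm{co}(A)\ne\mathrm{ro}(B)$. Let $\hat{\mathcal K}$ be the $\mathbb Q(v)$-space of formal sums $\sum_{A\in\widetilde\Theta}\xi_A[A]$, $\xi_A\in\mathbb Q(v)$, such that for every $\mathbf t\in\mathbb Z^n$ only finitely many $A$ with $\mathrm{ro}(A)=\mathbf t$, and only finitely many $A$ with $\mathrm{co}(A)=\mathbf t$, have $\xi_A\neq0$; its product is $\sum_A\xi_A[A]\cdot\sum_B\eta_B[B]=\sum_{A,B}\xi_A\eta_B\,[A]\cdot[B]$.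 For $\hat A\in\widetilde\Theta$ with zero diagonal and $\mathbf j\in\mathbb Z^n$ put $\hat A(\mathbf j)=\sum_{\lambda\in\mathbb Z^n}v^{\lambda_1j_1+\dots+\lambda_nj_n}[\hat A+\mathrm{diag}(\lambda)]\in\hat{\mathcal K}$. Let $\underline i$ be the $i$-th unit vector and $E_{ij}$ the matrix units, and define $$\overline t_{ij}=-(v^{-1}-v)\,E_{ij}(\underline i)\ (i<j),\qquad \overline t_{ii}=0(\underline i),\qquad \overline t_{ij}=0\ (i>j).$$ Let $\mathcal U\subset\hat{\mathcal K}$ be the subalgebra generated by all $\overline t_{ij}$, $1\le i,j\le n$. Then for all $i,j,a,b\in\{1,\dots,n\}$ the products of basis elements that enter $\overline t_{ia}\overline t_{jb}$ are well defined (for all large $p$ the polynomials $g$ that enter $[A+pI]*[B+pI]$, and the family $(G_Z)$, exist and are unique), and in $\mathcal U$ $$v^{-\delta_{ij}}\,\overline t_{ia}\overline t_{jb}-v^{-\delta_{ab}}\,\overline t_{jb}\overline t_{ia}=(v^{-1}-v)(\delta_{b<a}-\delta_{i<j})\,\overline t_{ja}\overline t_{ib},$$ where $\delta_P$ is $1$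 if $P$ holds and $0$ otherwise. -/

import Mathlib

open scoped Polynomial

noncomputable section

namespace BLM

/-! ### Partial flags over finite fields and their relative position -/

/-- `n`-step flags `0 = V₀ ⊆ V₁ ⊆ ⋯ ⊆ Vₙ = F ^ d`. -/
structure Flag (F : Type) [Field F] (n d : ℕ) where
  space : Fin (n + 1) → Submodule F (Fin d → F)
  le_succ : ∀ i : Fin n, space i.castSucc ≤ space i.succ
  space_zero : space 0 = ⊥
  space_last : space (Fin.last n) = ⊤

/-- The matrix of the pair `(V, W)`: its `(i, j)` entry is
`dim (Vᵢ₋₁ + Vᵢ ∩ Wⱼ) / (Vᵢ₋₁ + Vᵢ ∩ Wⱼ₋₁)`. With indices in `Fin n`, the step number `i` of the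
flag goes from `V.space i.castSucc` to `V.space i.succ`. -/
def relPos {F : Type} [Field F] {n d : ℕ} (V W : Flag F n d) : Matrix (Fin n) (Fin n) ℕ :=
  Matrix.of fun i j =>
    Module.finrank F
      (↥(V.space i.castSucc ⊔ V.space i.succ ⊓ W.space j.succ) ⧸
        (V.space i.castSucc ⊔ V.space i.succ ⊓ W.space j.castSucc).submoduleOf
          (V.space i.castSucc ⊔ V.space i.succ ⊓ W.space j.succ))

/-- `Θ_d`: the `n × n` matrices over `ℕ` with sum of entries `d`. They label the orbits of
`GL_d(F)` on pairs of flags. -/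
abbrev Theta (n d : ℕ) : Type := {M : Matrix (Fin n) (Fin n) ℕ // ∑ i, ∑ j, M i j = d}

theorem theta_entry_le {n d : ℕ} (M : Theta n d) (i j : Fin n) : M.1 i j ≤ d := by
  refine le_trans ?_ M.2.le
  exact (Finset.single_le_sum (f := fun j => M.1 i j) (fun _ _ => Nat.zero_le _)
    (Finset.mem_univ j)).trans
      (Finset.single_le_sum (f := fun i => ∑ j, M.1 i j) (fun _ _ => Nat.zero_le _)
        (Finset.mem_univ i))

instance instFiniteTheta (n d : ℕ) : Finite (Theta n d) :=
  Finite.of_injective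
    (fun (M : Theta n d) (i j : Fin n) =>
      (⟨M.1 i j, Nat.lt_succ_of_le (theta_entry_le M i j)⟩ : Fin (d + 1)))
    (fun _ _ h => Subtype.ext (Matrix.ext fun i j =>
      congrArg Fin.val (congrFun (congrFun h i) j)))

instance instFintypeTheta (n d : ℕ) : Fintype (Theta n d) := Fintype.ofFinite _

/-- `P` computes the coefficient of `e_C` in the convolution product `e_A * e_B` over all finite
fields of odd characteristic, as a polynomial in the number `q` of elements of the field. -/
def IsCountingPolynomial {n d : ℕ} (A B C : Theta n d) (P : ℤ[X]) : Prop :=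
  ∀ (F : Type) [Field F] [Fintype F], ringChar F ≠ 2 →
    ∀ V W : Flag F n d, relPos V W = C.1 →
      (Nat.card {U : Flag F n d // relPos V U = A.1 ∧ relPos U W = B.1} : ℤ) =
        P.eval (Fintype.card F : ℤ)

open Classical in
/-- The coefficient of `e_C` in `e_A * e_B`, as the polynomial in `q = v²` (it exists and is
unique; the value `0` in the other case is never used). -/
def countingPolynomial {n d : ℕ} (A B C : Theta n d) : ℤ[X] :=
  if h : ∃ P, IsCountingPolynomial A B C P then h.choose else 0

/-! ### The generic Schur algebra, with scalars extended to `ℚ(v)` -/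

/-- The field `ℚ(v)`. -/
abbrev Qv : Type := RatFunc ℚ

/-- The indeterminate `v`. -/
def v : Qv := RatFunc.X

/-- The Schur algebra `S_d` over `ℚ(v)`. An invariant function on pairs of flags is a function on
the set `Θ_d` of orbits. -/
abbrev Schur (n d : ℕ) : Type := Theta n d → Qv

/-- The convolution product of the generic Schur algebra, in which `q = v²`. -/
def schurMul {n d : ℕ} (f g : Schur n d) : Schur n d := fun C =>
  ∑ A, ∑ B, f A * g B * Polynomial.aeval (v ^ 2) (countingPolynomial A B C)

/-- `d(A) = dim O_A = ∑ a_{ij} a_{kl}` over `i < k` or `j < l`. -/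
def orbitDim {n : ℕ} (A : Matrix (Fin n) (Fin n) ℕ) : ℤ :=
  ∑ i, ∑ j, ∑ k, ∑ l, if i < k ∨ j < l then (A i j : ℤ) * (A k l : ℤ) else 0

/-- `r(A) = dim O_B`, where `B` is diagonal with entries the row sums of `A`. -/
def orbitRowDim {n : ℕ} (A : Matrix (Fin n) (Fin n) ℕ) : ℤ :=
  orbitDim (Matrix.diagonal fun i => ∑ j, A i j)

open Classical in
/-- The element `[M] = v ^ (-(d(M) - r(M))) e_M` of `S_d` for an integer matrix `M` in `Θ_d`
(and `0` for integer matrices not in `Θ_d`). -/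
def bracket {n : ℕ} (d : ℕ) (M : Matrix (Fin n) (Fin n) ℤ) : Schur n d := fun C =>
  if C.1.map (fun m : ℕ => (m : ℤ)) = M then v ^ (-(orbitDim C.1 - orbitRowDim C.1)) else 0

/-! ### Stabilization and the algebra `K` -/

/-- `Θ̃`: integer `n × n` matrices with nonnegative entries off the diagonal. -/
abbrev ThetaTilde (n : ℕ) : Type :=
  {M : Matrix (Fin n) (Fin n) ℤ // ∀ i j, i ≠ j → 0 ≤ M i j}

/-- Row sums. -/
def ro {n : ℕ} (A : ThetaTilde n) : Fin n → ℤ := fun i => ∑ j, A.1 i j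

/-- Column sums. -/
def co {n : ℕ} (A : ThetaTilde n) : Fin n → ℤ := fun j => ∑ i, A.1 i j

/-- The matrix `ₚA = A + p I`. -/
def shift {n : ℕ} (p : ℕ) (A : ThetaTilde n) : Matrix (Fin n) (Fin n) ℤ :=
  A.1 + (p : ℤ) • (1 : Matrix (Fin n) (Fin n) ℤ)

/-- The finite family `G = (G_Z)` of polynomials in `v'` over `ℚ(v)` satisfies
`[ₚA] * [ₚB] = ∑_Z G_Z(v, v⁻ᵖ) [ₚZ]` for all large `p`. (The matrices `Z` that occur in the product
have the row sums of `A` and the column sums of `B`.) -/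
def IsStabilization {n : ℕ} (A B : ThetaTilde n) (G : ThetaTilde n →₀ Qv[X]) : Prop :=
  (∀ Z ∈ G.support, ro Z = ro A ∧ co Z = co B) ∧
  ∃ p₀ : ℕ, ∀ p : ℕ, p₀ ≤ p → ∀ d : ℕ,
    schurMul (bracket d (shift p A)) (bracket d (shift p B)) =
      G.sum fun Z g => g.eval (v ^ (-(p : ℤ))) • bracket d (shift p Z)

/-- The stabilized product of `[A]` and `[B]` is well defined: for large `p` the structure
constants of the Schur algebra that enter `[ₚA] * [ₚB]` exist and are unique, and so does the
family `G` with `[ₚA] * [ₚB] = ∑_Z G_Z(v, v⁻ᵖ) [ₚZ]`. -/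
def StableProductDefined {n : ℕ} (A B : ThetaTilde n) : Prop :=
  (∃ p₀ : ℕ, ∀ p : ℕ, p₀ ≤ p → ∀ (d : ℕ) (A' B' C : Theta n d),
    A'.1.map (fun m : ℕ => (m : ℤ)) = shift p A → B'.1.map (fun m : ℕ => (m : ℤ)) = shift p B →
      ∃! P : ℤ[X], IsCountingPolynomial A' B' C P) ∧
  ∃! G : ThetaTilde n →₀ Qv[X], IsStabilization A B G

open Classical in
/-- The product `[A] · [B] = ∑_Z G_Z(v, 1) [Z]` in `K`, extended to `ℚ(v)`; it is `0` if
`co A ≠ ro B`. -/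
def kMul {n : ℕ} (A B : ThetaTilde n) : ThetaTilde n →₀ Qv :=
  if h : co A = ro B ∧ ∃ G, IsStabilization A B G then
    h.2.choose.mapRange (Polynomial.eval 1) Polynomial.eval_zero
  else 0

theorem kMul_ne_zero {n : ℕ} {A B C : ThetaTilde n} (h : kMul A B C ≠ 0) :
    co A = ro B ∧ ro C = ro A ∧ co C = co B := by
  unfold kMul at h
  split_ifs at h with hAB
  · refine ⟨hAB.1, hAB.2.choose_spec.1 C ?_⟩
    rw [Finsupp.mem_support_iff]
    intro h0
    exact h (by rw [Finsupp.mapRange_apply, h0, Polynomial.eval_zero])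
  · simp at h

/-! ### The completed algebra `K̂` -/

/-- `K̂`: formal sums `∑ ξ_A [A]` over `Θ̃` with finitely many nonzero terms of each given vector of
row sums and of each given vector of column sums. -/
def Khat (n : ℕ) : Submodule Qv (ThetaTilde n → Qv) where
  carrier := {ξ | ∀ t : Fin n → ℤ,
    {A | ro A = t ∧ ξ A ≠ 0}.Finite ∧ {A | co A = t ∧ ξ A ≠ 0}.Finite}
  zero_mem' := fun t => by simp
  add_mem' := fun {ξ η} hξ hη t => by
    constructor
    · refine ((hξ t).1.union (hη t).1).subset ?_
      rintro A ⟨hA, h⟩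
      by_cases h1 : ξ A = 0
      · exact Or.inr ⟨hA, fun h2 => h (by simp [h1, h2])⟩
      · exact Or.inl ⟨hA, h1⟩
    · refine ((hξ t).2.union (hη t).2).subset ?_
      rintro A ⟨hA, h⟩
      by_cases h1 : ξ A = 0
      · exact Or.inr ⟨hA, fun h2 => h (by simp [h1, h2])⟩
      · exact Or.inl ⟨hA, h1⟩
  smul_mem' := fun c ξ hξ t => by
    constructor
    · refine (hξ t).1.subset ?_
      rintro A ⟨hA, h⟩
      exact ⟨hA, fun h2 => h (by simp [h2])⟩
    · refine (hξ t).2.subset ?_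
      rintro A ⟨hA, h⟩
      exact ⟨hA, fun h2 => h (by simp [h2])⟩

/-- The coefficients of `(∑ ξ_A [A]) · (∑ η_B [B]) = ∑ ξ_A η_B [A] · [B]`. -/
def mulCoeff {n : ℕ} (ξ η : ThetaTilde n → Qv) : ThetaTilde n → Qv := fun C =>
  ∑ᶠ p : ThetaTilde n × ThetaTilde n, ξ p.1 * η p.2 * kMul p.1 p.2 C

theorem mulCoeff_support_finite {n : ℕ} (ξ η : Khat n) (C : ThetaTilde n) :
    (Function.support fun p : ThetaTilde n × ThetaTilde n =>
      ξ.1 p.1 * η.1 p.2 * kMul p.1 p.2 C).Finite := by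
  refine ((ξ.2 (ro C)).1.prod (η.2 (co C)).2).subset ?_
  rintro ⟨A, B⟩ h
  obtain ⟨h1, h2⟩ := mul_ne_zero_iff.1 h
  obtain ⟨h3, h4⟩ := mul_ne_zero_iff.1 h1
  obtain ⟨-, h5, h6⟩ := kMul_ne_zero h2
  exact ⟨⟨h5.symm, h3⟩, ⟨h6.symm, h4⟩⟩

theorem exists_of_mulCoeff_ne_zero {n : ℕ} {ξ η : ThetaTilde n → Qv} {C : ThetaTilde n}
    (h : mulCoeff ξ η C ≠ 0) : ∃ A B, ξ A ≠ 0 ∧ η B ≠ 0 ∧ kMul A B C ≠ 0 := by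
  have hex : ∃ p : ThetaTilde n × ThetaTilde n, ξ p.1 * η p.2 * kMul p.1 p.2 C ≠ 0 := by
    by_contra hne
    push Not at hne
    exact h (finsum_eq_zero_of_forall_eq_zero hne)
  obtain ⟨⟨A, B⟩, hp⟩ := hex
  obtain ⟨h1, h2⟩ := mul_ne_zero_iff.1 hp
  obtain ⟨h3, h4⟩ := mul_ne_zero_iff.1 h1
  exact ⟨A, B, h3, h4, h2⟩

theorem mulCoeff_mem {n : ℕ} (ξ η : Khat n) : mulCoeff ξ.1 η.1 ∈ Khat n := by
  intro t
  constructor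
  · refine ((ξ.2 t).1.biUnion fun A _ => (η.2 (co A)).1.biUnion fun B _ =>
      (kMul A B).support.finite_toSet).subset ?_
    rintro C ⟨hC, h⟩
    obtain ⟨A, B, h1, h2, h3⟩ := exists_of_mulCoeff_ne_zero h
    obtain ⟨h4, h5, h6⟩ := kMul_ne_zero h3
    refine Set.mem_biUnion (x := A) ⟨h5 ▸ hC, h1⟩ (Set.mem_biUnion (x := B) ⟨h4.symm, h2⟩ ?_)
    simpa using h3
  · refine ((η.2 t).2.biUnion fun B _ => (ξ.2 (ro B)).2.biUnion fun A _ =>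
      (kMul A B).support.finite_toSet).subset ?_
    rintro C ⟨hC, h⟩
    obtain ⟨A, B, h1, h2, h3⟩ := exists_of_mulCoeff_ne_zero h
    obtain ⟨h4, h5, h6⟩ := kMul_ne_zero h3
    refine Set.mem_biUnion (x := B) ⟨h6 ▸ hC, h2⟩ (Set.mem_biUnion (x := A) ⟨h4, h1⟩ ?_)
    simpa using h3

instance instMulKhat (n : ℕ) : Mul (Khat n) := ⟨fun ξ η => ⟨mulCoeff ξ.1 η.1, mulCoeff_mem ξ η⟩⟩

theorem Khat_mul_apply {n : ℕ} (ξ η : Khat n) (C : ThetaTilde n) :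
    (ξ * η).1 C = ∑ᶠ p : ThetaTilde n × ThetaTilde n, ξ.1 p.1 * η.1 p.2 * kMul p.1 p.2 C := rfl

instance instRingKhat (n : ℕ) : NonUnitalNonAssocRing (Khat n) :=
  { (inferInstance : AddCommGroup (Khat n)), instMulKhat n with
    left_distrib := fun ξ η ζ => by
      refine Subtype.ext (funext fun C => ?_)
      change (ξ * (η + ζ)).1 C = (ξ * η).1 C + (ξ * ζ).1 C
      simp only [Khat_mul_apply]
      rw [← finsum_add_distrib (mulCoeff_support_finite ξ η C) (mulCoeff_support_finite ξ ζ C)]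
      refine finsum_congr fun p => ?_
      change ξ.1 p.1 * (η.1 p.2 + ζ.1 p.2) * _ = _
      ring
    right_distrib := fun ξ η ζ => by
      refine Subtype.ext (funext fun C => ?_)
      change ((ξ + η) * ζ).1 C = (ξ * ζ).1 C + (η * ζ).1 C
      simp only [Khat_mul_apply]
      rw [← finsum_add_distrib (mulCoeff_support_finite ξ ζ C) (mulCoeff_support_finite η ζ C)]
      refine finsum_congr fun p => ?_
      change (ξ.1 p.1 + η.1 p.1) * ζ.1 p.2 * _ = _
      ring
    zero_mul := fun ξ => by
      refine Subtype.ext (funext fun C => ?_)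
      change ((0 : Khat n) * ξ).1 C = 0
      rw [Khat_mul_apply]
      refine finsum_eq_zero_of_forall_eq_zero fun p => ?_
      change (0 : Qv) * ξ.1 p.2 * _ = 0
      ring
    mul_zero := fun ξ => by
      refine Subtype.ext (funext fun C => ?_)
      change (ξ * (0 : Khat n)).1 C = 0
      rw [Khat_mul_apply]
      refine finsum_eq_zero_of_forall_eq_zero fun p => ?_
      change ξ.1 p.1 * (0 : Qv) * _ = 0
      ring }

instance instScalarTowerKhat (n : ℕ) : IsScalarTower Qv (Khat n) (Khat n) :=
  ⟨fun c ξ η => by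
    refine Subtype.ext (funext fun C => ?_)
    change ((c • ξ) * η).1 C = c * (ξ * η).1 C
    rw [Khat_mul_apply, Khat_mul_apply, mul_finsum]
    refine finsum_congr fun p => ?_
    change c * ξ.1 p.1 * η.1 p.2 * _ = _
    ring⟩

instance instSMulCommKhat (n : ℕ) : SMulCommClass Qv (Khat n) (Khat n) :=
  ⟨fun c ξ η => by
    refine Subtype.ext (funext fun C => ?_)
    change c * (ξ * η).1 C = (ξ * (c • η)).1 C
    rw [Khat_mul_apply, Khat_mul_apply, mul_finsum]
    refine finsum_congr fun p => ?_
    change _ = ξ.1 p.1 * (c * η.1 p.2) * _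
    ring⟩

/-! ### The elements `Â(j)` and the generators of `U` -/

/-- `Θ⁰`: the matrices in `Θ̃` with zero diagonal. -/
abbrev ThetaZero (n : ℕ) : Type := {A : ThetaTilde n // ∀ i, A.1 i i = 0}

/-- `Â + D_λ`. -/
def addDiag {n : ℕ} (A : ThetaZero n) (lam : Fin n → ℤ) : ThetaTilde n :=
  ⟨A.1.1 + Matrix.diagonal lam, fun i j hij => by
    simpa [Matrix.diagonal_apply_ne _ hij] using A.1.2 i j hij⟩

theorem ro_addDiag {n : ℕ} (A : ThetaZero n) (lam : Fin n → ℤ) (i : Fin n) :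
    ro (addDiag A lam) i = ro A.1 i + lam i := by
  simp [ro, addDiag, Finset.sum_add_distrib, Matrix.diagonal_apply]

theorem co_addDiag {n : ℕ} (A : ThetaZero n) (lam : Fin n → ℤ) (i : Fin n) :
    co (addDiag A lam) i = co A.1 i + lam i := by
  simp [co, addDiag, Finset.sum_add_distrib, Matrix.diagonal_apply]

open Classical in
/-- `Â(j) = ∑_λ v ^ (λ₁ j₁ + ⋯ + λₙ jₙ) [Â + D_λ]`, the sum over all `λ ∈ ℤⁿ`. The coefficient of
`[M]` is nonzero only if `M = Â + D_λ`, and then `λ` is the diagonal of `M`. -/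
def hatElt {n : ℕ} (A : ThetaZero n) (j : Fin n → ℤ) : Khat n :=
  ⟨fun M => if ∃ lam, M = addDiag A lam then v ^ (∑ k, M.1 k k * j k) else 0, fun t => by
    constructor
    · refine (Set.finite_singleton (addDiag A fun i => t i - ro A.1 i)).subset ?_
      rintro M ⟨hM, h⟩
      obtain ⟨lam, rfl⟩ := (ite_ne_right_iff.1 h).1
      refine congrArg (addDiag A) (funext fun i => ?_)
      have := congrFun hM i
      rw [ro_addDiag] at this
      omega
    · refine (Set.finite_singleton (addDiag A fun i => t i - co A.1 i)).subset ?_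
      rintro M ⟨hM, h⟩
      obtain ⟨lam, rfl⟩ := (ite_ne_right_iff.1 h).1
      refine congrArg (addDiag A) (funext fun i => ?_)
      have := congrFun hM i
      rw [co_addDiag] at this
      omega⟩

/-- The zero matrix, as an element of `Θ⁰`. -/
def zeroMat (n : ℕ) : ThetaZero n := ⟨⟨0, fun _ _ _ => le_refl _⟩, fun _ => rfl⟩

/-- The matrix unit `E_{ij}`, `i < j`, as an element of `Θ⁰`. -/
def unitMat {n : ℕ} (i j : Fin n) (hij : i < j) : ThetaZero n :=
  ⟨⟨Matrix.single i j 1, fun k l _ => by rw [Matrix.single_apply]; split_ifs <;> simp⟩, fun k => by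
    change Matrix.single i j (1 : ℤ) k k = 0
    rw [Matrix.single_apply, if_neg]
    rintro ⟨rfl, rfl⟩
    exact lt_irrefl _ hij⟩

/-- The generators: `t̄_{ij} = -(v⁻¹ - v) E_{ij}(i)` for `i < j`, `t̄_{ii} = 0(i)`, and
`t̄_{ij} = 0` for `i > j`; the argument `(i)` is the `i`-th unit vector of `ℤⁿ`. -/
def tbar {n : ℕ} (i j : Fin n) : Khat n :=
  if hij : i < j then (-(v⁻¹ - v)) • hatElt (unitMat i j hij) (Pi.single i 1)
  else if i = j then hatElt (zeroMat n) (Pi.single i 1)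
  else 0

/-- The subalgebra `U` of `K̂` generated by the `t̄_{ij}` (with the unit `0(0) = ∑_λ [D_λ]`
of `K̂`). -/
def U (n : ℕ) : NonUnitalSubalgebra Qv (Khat n) :=
  NonUnitalAlgebra.adjoin Qv
    (insert (hatElt (zeroMat n) 0) (Set.range fun p : Fin n × Fin n => tbar p.1 p.2))

/-- The generators as elements of `U`. -/
def tU {n : ℕ} (i j : Fin n) : U n :=
  ⟨tbar i j, NonUnitalAlgebra.subset_adjoin Qv (Set.mem_insert_of_mem _ ⟨(i, j), rfl⟩)⟩

/-- The Kronecker symbol of a proposition: `1` if it holds and `0` otherwise. -/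
def delta (p : Prop) [Decidable p] : ℤ := if p then 1 else 0

end BLM

end

/-! A term `[C]` of `t̄_{ia} t̄_{jb}` comes from a single pair of basis elements: the row sums of
`C` and the condition `co A = ro B` force `A = E_{ia} + E_{jj} + diag ν` and `B = E_{jb} + E_{aa} +
diag ν` with one and the same `ν`, where `i ≤ a` and `j ≤ b`. So only products of two such steps
have to be known.

Once the dimensions in `V` are prescribed, a pair of flags `(V, U)` has position `A` exactly when `U
⊆ V` and the quotient `V/U`, as a representation of the linear quiver, is the interval module on `i
< s ≤ a`. A flag between `V` and `W` therefore presents `V/W` as an extension of the interval `(i,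
a]` by the interval `(j, b]`. The extension is the direct sum or, only when `i < j ≤ a < b`, it can
be nonsplit with middle term `(i, b] ⊕ (j, a]` (`IsStep.comp`). Hence a product has at most two
terms, `E_{ia} + E_{jb} + diag ν` and `E_{ib} + E_{ja} + diag ν`.

For the coefficients, an intermediate flag is determined by its space at the first index `m` where
the two intervals overlap, that is by a line in the plane `V_m/W_m`. Each end at which the intervals
differ singles out one line, which is excluded or forced. This gives `q + 1`, `q` or `1` in the
split case and `q - 1` or `1` in the nonsplit case (`card_midFlags_eq`).

After normalization the parts of `d - r` that depend on `ν` cancel, so the structure constants do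
not change under `A ↦ A + pI` and the stabilizing family is constant in `v'`
(`isStabilization_stepFamily`). All three products in the relation carry the factor `v ^ (ν i + ν
j)` and involve the same two matrices, whose roles are exchanged in `t̄_{ja} t̄_{ib}`. What is left
is a scalar identity, checked for each order type of `i, j, a, b` (`stepVal_relation`). -/

noncomputable section

namespace BLM

open Module

/-! ### Chains of subspaces -/

section Chains

variable {F E : Type*} [Field F] [AddCommGroup E] [Module F E]

/-- The indicator of `k < r ∧ s ≤ l`. -/
def box (k l r s : ℕ) : ℕ := if k < r ∧ s ≤ l then 1 else 0

/-- `W ≤ V`, and `V r ⊓ W s` has codimension `δ r s` in `V r` for `r ≤ s`. -/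
structure HasDefect (V W : ℕ → Submodule F E) (δ : ℕ → ℕ → ℕ) : Prop where
  le : ∀ s, W s ≤ V s
  finrank_inf : ∀ r s, r ≤ s → finrank F ↥(V r ⊓ W s) + δ r s = finrank F (V r)

/-- The quotient of `V` by `U` is the interval representation supported on `i < s ≤ a`. -/
structure IsStep (i a : ℕ) (V U : ℕ → Submodule F E) : Prop where
  le : ∀ s, U s ≤ V s
  ge : ∀ s, ¬(i < s ∧ s ≤ a) → V s ≤ U s
  rank : ∀ s, i < s → s ≤ a → finrank F (V s) = finrank F (U s) + 1
  inf_succ_le : ∀ s, i < s → s + 1 ≤ a → V s ⊓ U (s + 1) ≤ U s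

variable {V U W : ℕ → Submodule F E} {i a j b : ℕ}

theorem IsStep.eq (h : IsStep i a V U) {s : ℕ} (hs : ¬(i < s ∧ s ≤ a)) : V s = U s :=
  le_antisymm (h.ge s hs) (h.le s)

/-- Injectivity of the structure maps of `V/U` along the support passes from neighbouring indices to
all pairs by composition. -/
theorem IsStep.inf_le (h : IsStep i a V U) (hV : Monotone V) {r s : ℕ} (hr : i < r) (hrs : r ≤ s)
    (hs : s ≤ a) : V r ⊓ U s ≤ U r := by
  induction s, hrs using Nat.le_induction with
  | base => exact inf_le_right
  | succ s hrs ih =>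
    refine le_trans (le_inf inf_le_left ?_) (ih (by omega))
    exact le_trans (inf_le_inf_right _ (hV hrs)) (h.inf_succ_le s (by omega) hs)

/-- Away from the region `i < r ≤ j ≤ a < s ≤ b`, the codimensions for a composite of two steps are
those for the direct sum of the two intervals. -/
def QuasiSplit (i a j b : ℕ) (V W : ℕ → Submodule F E) : Prop :=
  (∀ s, W s ≤ V s) ∧ ∀ r s, r ≤ s → ¬(i < r ∧ r ≤ j ∧ j ≤ a ∧ a < s ∧ s ≤ b) →
    finrank F ↥(V r ⊓ W s) + (box i a r s + box j b r s) = finrank F (V r)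

theorem HasDefect.quasiSplit (h : HasDefect V W (fun r s => box i a r s + box j b r s)) :
    QuasiSplit i a j b V W :=
  ⟨h.le, fun r s hrs _ => h.finrank_inf r s hrs⟩

/-- The split and the nonsplit defect differ only on the rectangle that `QuasiSplit` leaves out, so
one treatment of intermediate chains serves both. -/
theorem HasDefect.quasiSplit_of_lt (h : HasDefect V W (fun r s => box i b r s + box j a r s))
    (hc : i < j ∧ j ≤ a ∧ a < b) : QuasiSplit i a j b V W := by
  refine ⟨h.le, fun r s hrs hn => ?_⟩
  rw [← h.finrank_inf r s hrs]
  simp only [box]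
  split_ifs <;> omega

theorem IsStep.inf_eq (h : IsStep i a V U) (hV : Monotone V) (hU : Monotone U) {r s : ℕ}
    (hr : i < r) (hrs : r ≤ s) (hs : s ≤ a) : V r ⊓ U s = U r :=
  le_antisymm (h.inf_le hV hr hrs hs) (le_inf (h.le r) (hU hrs))

theorem IsStep.hasDefect (h : IsStep i a V U) (hV : Monotone V) (hU : Monotone U) :
    HasDefect V U (box i a) := by
  refine ⟨h.le, fun r s hrs => ?_⟩
  unfold box
  split_ifs with hc
  · rw [h.inf_eq hV hU hc.1 hrs hc.2, h.rank r hc.1 (hrs.trans hc.2)]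
  · have : V r ≤ U s := by
      by_cases hr : i < r
      · exact (hV hrs).trans (h.ge s (by omega))
      · exact (h.ge r (by omega)).trans (hU hrs)
    rw [inf_eq_left.2 this, add_zero]

variable [FiniteDimensional F E]

theorem le_of_finrank_inf {X Y : Submodule F E} (h : finrank F ↥(X ⊓ Y) = finrank F X) : X ≤ Y :=
  inf_eq_left.1 (Submodule.eq_of_le_of_finrank_eq inf_le_left h)

theorem inf_le_of_finrank {X Y T : Submodule F E} (hT : T ≤ X ⊓ Y)
    (h : finrank F ↥(X ⊓ Y) ≤ finrank F T) : X ⊓ Y ≤ T :=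
  (Submodule.eq_of_le_of_finrank_le hT h).ge

/-- Only the defects at `(s, s)` and `(s, s + 1)` enter: the first gives the ranks, and equality of
the two gives injectivity of the map from `s` to `s + 1`. -/
theorem HasDefect.isStep (h : HasDefect V U (box i a)) (hU : Monotone U) : IsStep i a V U := by
  have key : ∀ s, finrank F (U s) + box i a s s = finrank F (V s) := fun s => by
    have := h.finrank_inf s s le_rfl
    rwa [inf_eq_right.2 (h.le s)] at this
  refine ⟨h.le, fun s hs => ?_, fun s h1 h2 => ?_, fun s h1 h2 => ?_⟩
  · refine le_of_finrank_inf ?_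
    simpa [box, hs] using h.finrank_inf s s le_rfl
  · have := key s
    rw [box, if_pos ⟨h1, h2⟩] at this
    exact this.symm
  · refine inf_le_of_finrank (le_inf (h.le s) (hU s.le_succ)) ?_
    have h3 := h.finrank_inf s (s + 1) s.le_succ
    have h4 := key s
    rw [box, if_pos ⟨h1, h2⟩] at h3
    rw [box, if_pos ⟨h1, by omega⟩] at h4
    omega

theorem isStep_iff (hV : Monotone V) (hU : Monotone U) :
    IsStep i a V U ↔ HasDefect V U (box i a) :=
  ⟨fun h => h.hasDefect hV hU, fun h => h.isStep hU⟩

theorem IsStep.quasiSplit (h₁ : IsStep i a V U) (h₂ : IsStep j b U W) (hV : Monotone V)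
    (hU : Monotone U) (hW : Monotone W) : QuasiSplit i a j b V W := by
  refine ⟨fun s => (h₂.le s).trans (h₁.le s), fun r s hrs hn => ?_⟩
  have hd := (h₂.hasDefect hU hW).finrank_inf r s hrs
  have full : V r ≤ W s → finrank F ↥(V r ⊓ W s) = finrank F (V r) := fun h => by
    rw [inf_eq_left.2 h]
  by_cases hc : i < r ∧ s ≤ a
  · have e : V r ⊓ W s = U r ⊓ W s := by
      refine le_antisymm (le_inf ?_ inf_le_right) (inf_le_inf_right _ (h₁.le r))
      exact (inf_le_inf_left _ (h₂.le s)).trans (h₁.inf_le hV hc.1 hrs hc.2)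
    rw [e, h₁.rank r hc.1 (hrs.trans hc.2)]
    simp only [box, if_pos hc] at hd ⊢
    omega
  · have b0 : box i a r s = 0 := if_neg hc
    by_cases hr : ¬(i < r ∧ r ≤ a)
    · rw [h₁.eq hr, b0, zero_add, hd]
    have hs : V s = U s := h₁.eq (by omega)
    by_cases hs' : ¬(j < s ∧ s ≤ b)
    · have b1 : box j b r s = 0 := if_neg (by omega)
      rw [full ((hV hrs).trans (hs.le.trans (h₂.ge s hs'))), b0, b1, add_zero, add_zero]
    -- Here `i < r ≤ a < s`, so `V s = U s` contains `W s` with codimension one. If `j < r`, then `U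
    -- r`, and a fortiori `V r`, is not inside `W s`, hence meets it in codimension one.
    by_cases hjr : j < r
    · have b1 : box j b r s = 1 := if_pos (by omega)
      have hlt : W s < W s ⊔ V r := by
        refine lt_of_le_of_ne le_sup_left fun he => ?_
        have : U r ⊓ W s = U r := inf_eq_left.2 ((h₁.le r).trans (he ▸ le_sup_right))
        rw [this, b1] at hd
        omega
      have hle : W s ⊔ V r ≤ U s := sup_le (h₂.le s) ((hV hrs).trans hs.le)
      have h3 := Submodule.finrank_lt_finrank_of_lt hlt
      have h4 := Submodule.finrank_mono hle
      have h5 := h₂.rank s (by omega) (by omega)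
      have h6 := Submodule.finrank_sup_add_finrank_inf_eq (V r) (W s)
      rw [sup_comm] at h6
      rw [b0, b1]
      omega
    · have b1 : box j b r s = 0 := if_neg (by omega)
      have : V r ≤ W s := by
        -- The excluded rectangle leaves only `a < j`, where neither step changes the space at `j`.
        have hj : V j = W j := by rw [h₁.eq (by omega), h₂.eq (by omega)]
        exact (hV (by omega)).trans (hj.le.trans (hW (by omega)))
      rw [full this, b0, b1, add_zero, add_zero]

/-- For `i < j ≤ a < b` the quotients `V_j/W_j` and `V_{a+1}/W_{a+1}` are one-dimensional. The map
between them is zero for the split extension and an isomorphism for the nonsplit one. -/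
theorem IsStep.comp (h₁ : IsStep i a V U) (h₂ : IsStep j b U W) (hV : Monotone V)
    (hU : Monotone U) (hW : Monotone W) :
    HasDefect V W (fun r s => box i a r s + box j b r s) ∨
      (i < j ∧ j ≤ a ∧ a < b) ∧ HasDefect V W (fun r s => box i b r s + box j a r s) := by
  have hq := h₁.quasiSplit h₂ hV hU hW
  by_cases hc : i < j ∧ j ≤ a ∧ a < b
  swap
  · exact Or.inl ⟨hq.1, fun r s hrs => hq.2 r s hrs (by omega)⟩
  by_cases hle : V j ≤ W (a + 1)
  · refine Or.inl ⟨hq.1, fun r s hrs => ?_⟩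
    by_cases hn : i < r ∧ r ≤ j ∧ j ≤ a ∧ a < s ∧ s ≤ b
    · have : V r ≤ W s := (hV hn.2.1).trans (hle.trans (hW (by omega)))
      rw [inf_eq_left.2 this, box, box, if_neg (by omega), if_neg (by omega), add_zero, add_zero]
    · exact hq.2 r s hrs hn
  · refine Or.inr ⟨hc, hq.1, fun r s hrs => ?_⟩
    by_cases hn : i < r ∧ r ≤ j ∧ j ≤ a ∧ a < s ∧ s ≤ b
    · have hj : U j = W j := h₂.eq (by omega)
      have e1 : V j ⊓ W (a + 1) ≤ U j := by
        refine inf_le_of_finrank (le_inf (h₁.le j) (hj.le.trans (hW (by omega)))) ?_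
        have h3 : finrank F ↥(V j ⊓ W (a + 1)) < finrank F (V j) :=
          Submodule.finrank_lt_finrank_of_lt (lt_of_le_of_ne inf_le_left
            fun he => hle (inf_eq_left.1 he))
        have := h₁.rank j (by omega) (by omega)
        omega
      -- The intersection is pushed down in turn into `W (a + 1)` by the second step, into `U j` by
      -- `e1`, and into `U r` by the first step.
      have e2 : V r ⊓ W s = U r := by
        refine le_antisymm ?_ (le_inf (h₁.le r) ((hU hn.2.1).trans (hj.le.trans (hW (by omega)))))
        have e3 : V r ⊓ W s ≤ W (a + 1) := by
          refine le_trans (inf_le_inf_right _ ?_)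
            (h₂.inf_le hU (r := a + 1) (s := s) (by omega) (by omega) (by omega))
          exact (hV (by omega)).trans (h₁.ge (a + 1) (by omega))
        refine le_trans (le_inf inf_le_left ?_)
          (h₁.inf_le hV (r := r) (s := j) (by omega) (by omega) (by omega))
        exact le_trans (le_inf (inf_le_left.trans (hV hn.2.1)) e3) e1
      rw [e2, h₁.rank r (by omega) (by omega), box, box, if_pos (by omega), if_neg (by omega)]
    · rw [← hq.2 r s hrs hn]
      simp only [box]
      split_ifs <;> omega

end Chains

/-! ### Lines in a two-dimensional quotient. -/

section Lines

variable {F E : Type*} [Field F] [AddCommGroup E] [Module F E] [FiniteDimensional F E]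

theorem finrank_map_mkQ_add {X P : Submodule F E} (h : X ≤ P) :
    finrank F ↥(P.map X.mkQ) + finrank F X = finrank F P := by
  have h1 := LinearMap.finrank_range_add_finrank_ker (X.mkQ.domRestrict P)
  rw [LinearMap.range_domRestrict, LinearMap.ker_domRestrict, Submodule.ker_mkQ] at h1
  rw [← h1, ← Submodule.finrank_map_subtype_eq P (X.comap P.subtype),
    Submodule.map_comap_subtype, inf_eq_right.2 h]

/-- The subspaces strictly between `X` and `Y` when `Y` has dimension two over `X`. -/
def lines (X Y : Submodule F E) : Set (Submodule F E) :=
  {L | X ≤ L ∧ L ≤ Y ∧ finrank F L = finrank F X + 1}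

/-- These subspaces are the points of the projective line of the two-dimensional quotient `Y ⧸ X`.
-/
theorem ncard_lines [Finite F] {X Y : Submodule F E} (hXY : X ≤ Y)
    (h : finrank F Y = finrank F X + 2) : (lines X Y).ncard = Nat.card F + 1 := by
  set X' : Submodule F Y := X.submoduleOf Y with hX'
  have hmapX : X'.map Y.subtype = X := by
    rw [hX', Submodule.submoduleOf, Submodule.map_comap_subtype, inf_eq_right.2 hXY]
  have hrX : finrank F X' = finrank F X := by
    rw [← Submodule.finrank_map_subtype_eq Y X', hmapX]
  have hQ : finrank F (Y ⧸ X') = 2 := by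
    have := Submodule.finrank_quotient_add_finrank X'
    omega
  rw [← Projectivization.card_of_finrank_two F _ hQ,
    Nat.card_congr (Projectivization.equivSubmodule F (Y ⧸ X')), ← Nat.card_coe_set_eq]
  have hr : ∀ S : Submodule F (Y ⧸ X'),
      finrank F ↥((S.comap X'.mkQ).map Y.subtype) = finrank F S + finrank F X := fun S => by
    rw [Submodule.finrank_map_subtype_eq,
      ← finrank_map_mkQ_add (Submodule.le_comap_mkQ X' S),
      Submodule.map_comap_eq_of_surjective (Submodule.mkQ_surjective _), hrX]
  symm
  refine Nat.card_eq_of_bijective (fun S => ⟨(S.1.comap X'.mkQ).map Y.subtype, ?_, ?_, ?_⟩)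
    ⟨?_, ?_⟩
  · exact hmapX.ge.trans (Submodule.map_mono (Submodule.le_comap_mkQ X' S.1))
  · exact Submodule.map_subtype_le _ _
  · rw [hr, S.2, add_comm]
  · intro S T hST
    have h1 := congrArg Subtype.val hST
    have h2 := Submodule.map_injective_of_injective Y.injective_subtype h1
    exact Subtype.ext (Submodule.comap_injective_of_surjective (Submodule.mkQ_surjective _) h2)
  · rintro ⟨L, h1, h2, h3⟩
    have e1 : ((L.submoduleOf Y).map X'.mkQ).comap X'.mkQ = L.submoduleOf Y := by
      rw [Submodule.comap_map_mkQ, sup_eq_right]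
      exact Submodule.comap_mono h1
    have e2 : (((L.submoduleOf Y).map X'.mkQ).comap X'.mkQ).map Y.subtype = L := by
      rw [e1, Submodule.submoduleOf, Submodule.map_comap_subtype, inf_eq_right.2 h2]
    refine ⟨⟨(L.submoduleOf Y).map X'.mkQ, ?_⟩, Subtype.ext e2⟩
    have := hr ((L.submoduleOf Y).map X'.mkQ)
    rw [e2, h3] at this
    omega

theorem lines_eq_of_le {X Y L L' : Submodule F E} (hL : L ∈ lines X Y) (hL' : L' ∈ lines X Y)
    (h : L ≤ L') : L = L' :=
  Submodule.eq_of_le_of_finrank_eq h (hL.2.2.trans hL'.2.2.symm)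

end Lines

/-! ### Intermediate chains are determined by one space on the overlap. -/

section Interpolation

variable {F E : Type*} [Field F] [AddCommGroup E] [Module F E]
  {V U W : ℕ → Submodule F E} {i a j b : ℕ} {L : Submodule F E}

/-- The chain between `V` and `W` that is `V` off `i < s ≤ a`, is `W` off `j < s ≤ b` and contains
`L` on the intersection of the two intervals. -/
def interp (i a j b : ℕ) (V W : ℕ → Submodule F E) (L : Submodule F E) (s : ℕ) : Submodule F E :=
  if i < s ∧ s ≤ a then if j < s ∧ s ≤ b then W s ⊔ L else W s else V s

theorem interp_of_mem_of_mem {s : ℕ} (hi : i < s ∧ s ≤ a) (hj : j < s ∧ s ≤ b) :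
    interp i a j b V W L s = W s ⊔ L := by
  rw [interp, if_pos hi, if_pos hj]

theorem interp_of_mem_of_not {s : ℕ} (hi : i < s ∧ s ≤ a) (hj : ¬(j < s ∧ s ≤ b)) :
    interp i a j b V W L s = W s := by
  rw [interp, if_pos hi, if_neg hj]

theorem interp_of_not {s : ℕ} (hi : ¬(i < s ∧ s ≤ a)) : interp i a j b V W L s = V s :=
  if_neg hi

/-- The conditions on the first space `L` on the intersection of the two intervals, for a chain
between `V` and `W` to be composed of two steps. -/
structure IsCut (i a j b : ℕ) (V W : ℕ → Submodule F E) (L : Submodule F E) : Prop where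
  mem : L ∈ lines (W (max i j + 1)) (V (max i j + 1))
  inf_le_left : i < j → V j ⊓ L ≤ W j
  le_left : j < i → V i ≤ L
  inf_le_right : a < b → L ⊓ W (a + 1) ≤ W (max i j + 1)
  le_right : b < a → L ≤ W (b + 1)

theorem QuasiSplit.finrank_eq (h : QuasiSplit i a j b V W) (s : ℕ) :
    finrank F (W s) + (box i a s s + box j b s s) = finrank F (V s) := by
  have := h.2 s s le_rfl (by omega)
  rwa [inf_eq_right.2 (h.1 s)] at this

theorem box_of_pos {k l r s : ℕ} (h : k < r ∧ s ≤ l) : box k l r s = 1 := if_pos h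

theorem box_of_neg {k l r s : ℕ} (h : ¬(k < r ∧ s ≤ l)) : box k l r s = 0 := if_neg h

theorem IsStep.isCut (h₁ : IsStep i a V U) (h₂ : IsStep j b U W) (hU : Monotone U)
    (hov : max i j < min a b) : IsCut i a j b V W (U (max i j + 1)) where
  mem := ⟨h₂.le _, h₁.le _, h₂.rank _ (by omega) (by omega)⟩
  inf_le_left h := by
    rw [max_eq_right h.le]
    exact (h₁.inf_succ_le j h (by omega)).trans (h₂.ge j (by omega))
  le_left h := by
    rw [max_eq_left h.le]
    exact (h₁.ge i (by omega)).trans (hU (Nat.le_succ i))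
  inf_le_right h := h₂.inf_le hU (by omega) (by omega) (by omega)
  le_right h := (hU (by omega)).trans (h₂.ge (b + 1) (by omega))

variable [FiniteDimensional F E]

/-- On the overlap `U s` contains `W s` with codimension one. The first space of `U` on the overlap
is not inside `W s`, by injectivity in the second step, so together with `W s` it spans `U s`. -/
theorem IsStep.eq_interp (h₁ : IsStep i a V U) (h₂ : IsStep j b U W) (hU : Monotone U) :
    U = interp i a j b V W (U (max i j + 1)) := by
  funext s
  unfold interp
  split_ifs with hi hj
  · symm
    have hle : W s ⊔ U (max i j + 1) ≤ U s := sup_le (h₂.le s) (hU (by omega))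
    refine Submodule.eq_of_le_of_finrank_le hle ?_
    have hlt : W s < W s ⊔ U (max i j + 1) := by
      refine lt_of_le_of_ne le_sup_left fun he => ?_
      have h3 : U (max i j + 1) ≤ W s := he ▸ le_sup_right
      have h4 := h₂.inf_le hU (r := max i j + 1) (s := s) (by omega) (by omega) (by omega)
      rw [inf_eq_left.2 h3] at h4
      have h5 := Submodule.finrank_mono h4
      have h6 := h₂.rank (max i j + 1) (by omega) (by omega)
      omega
    have h3 := Submodule.finrank_lt_finrank_of_lt hlt
    have h4 := h₂.rank s (by omega) (by omega)
    omega
  · exact h₂.eq hj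
  · exact (h₁.eq hi).symm

/-- If the defect at `(r, s)` equals the defect at `(r, r)`, then `V r ⊓ W s ≤ W r`. -/
theorem QuasiSplit.inf_le (h : QuasiSplit i a j b V W) (hW : Monotone W) {r s : ℕ} (hrs : r ≤ s)
    (hn : ¬(i < r ∧ r ≤ j ∧ j ≤ a ∧ a < s ∧ s ≤ b))
    (he : box i a r s + box j b r s = box i a r r + box j b r r) : V r ⊓ W s ≤ W r := by
  refine inf_le_of_finrank (le_inf (h.1 r) (hW hrs)) ?_
  have h1 := h.2 r s hrs hn
  have h2 := h.finrank_eq r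
  omega

theorem QuasiSplit.le (h : QuasiSplit i a j b V W) {r s : ℕ} (hrs : r ≤ s)
    (hn : ¬(i < r ∧ r ≤ j ∧ j ≤ a ∧ a < s ∧ s ≤ b))
    (he : box i a r s + box j b r s = 0) : V r ≤ W s := by
  refine le_of_finrank_inf ?_
  have h1 := h.2 r s hrs hn
  omega

/-- The defect is constantly two on the overlap, so `V (max i j + 1)`, and with it `L`, meets `W s`
only in `W (max i j + 1)`. -/
theorem QuasiSplit.finrank_sup (h : QuasiSplit i a j b V W) (hW : Monotone W)
    (hL : IsCut i a j b V W L) {s : ℕ} (hi : i < s ∧ s ≤ a) (hj : j < s ∧ s ≤ b) :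
    L ⊓ W s ≤ W (max i j + 1) ∧ finrank F ↥(W s ⊔ L) = finrank F (W s) + 1 := by
  obtain ⟨h1, h2, h3⟩ := hL.mem
  have hle : L ⊓ W s ≤ W (max i j + 1) := by
    refine (inf_le_inf_right _ h2).trans (h.inf_le hW (by omega) (by omega) ?_)
    rw [box_of_pos (by omega), box_of_pos (by omega), box_of_pos (by omega), box_of_pos (by omega)]
  refine ⟨hle, ?_⟩
  have he : L ⊓ W s = W (max i j + 1) := le_antisymm hle (le_inf h1 (hW (by omega)))
  have h4 := Submodule.finrank_sup_add_finrank_inf_eq L (W s)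
  rw [he, sup_comm] at h4
  omega

/-- The cut conditions matter only at an end of an interval: `le_left` where the first interval
starts inside the second, `le_right` where the second ends inside the first. The other two
conditions give injectivity in `isStep_interp_left` and `isStep_interp_right`. -/
theorem QuasiSplit.monotone_interp (h : QuasiSplit i a j b V W) (hV : Monotone V)
    (hW : Monotone W) (hL : max i j < min a b → IsCut i a j b V W L) :
    Monotone (interp i a j b V W L) := by
  refine monotone_nat_of_le_succ fun s => ?_
  have hle : interp i a j b V W L s ≤ V s := by
    unfold interp
    split_ifs with hi hj
    · exact sup_le (h.1 s) ((hL (by omega)).mem.2.1.trans (hV (by omega)))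
    · exact h.1 s
    · exact le_rfl
  by_cases hi' : i < s + 1 ∧ s + 1 ≤ a
  swap
  · rw [show interp i a j b V W L (s + 1) = V (s + 1) from if_neg hi']
    exact hle.trans (hV s.le_succ)
  by_cases hj' : j < s + 1 ∧ s + 1 ≤ b
  · rw [interp_of_mem_of_mem hi' hj']
    unfold interp
    split_ifs with hi hj
    · exact sup_le_sup_right (hW s.le_succ) _
    · exact (hW s.le_succ).trans le_sup_left
    · have : s = i := by omega
      subst this
      by_cases hj : j < s
      · exact ((hL (by omega)).le_left hj).trans le_sup_right
      · refine le_trans ?_ ((hW s.le_succ).trans le_sup_left)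
        exact h.le le_rfl (by omega) (by rw [box_of_neg (by omega), box_of_neg (by omega)])
  · rw [interp_of_mem_of_not hi' hj']
    unfold interp
    split_ifs with hi hj
    · have : s = b := by omega
      subst this
      exact sup_le (hW s.le_succ) ((hL (by omega)).le_right (by omega))
    · exact hW s.le_succ
    · exact h.le s.le_succ (by omega) (by rw [box_of_neg (by omega), box_of_neg (by omega)])

theorem QuasiSplit.isStep_interp_left (h : QuasiSplit i a j b V W) (hV : Monotone V)
    (hW : Monotone W) (hL : max i j < min a b → IsCut i a j b V W L) :
    IsStep i a V (interp i a j b V W L) where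
  le s := by
    unfold interp
    split_ifs with hi hj
    · exact sup_le (h.1 s) ((hL (by omega)).mem.2.1.trans (hV (by omega)))
    · exact h.1 s
    · exact le_rfl
  ge s hs := by rw [interp, if_neg hs]
  rank s h1 h2 := by
    have h3 := h.finrank_eq s
    rw [box_of_pos ⟨h1, h2⟩] at h3
    by_cases hj : j < s ∧ s ≤ b
    · rw [interp_of_mem_of_mem ⟨h1, h2⟩ hj, (h.finrank_sup hW (hL (by omega)) ⟨h1, h2⟩ hj).2]
      rw [box_of_pos hj] at h3
      omega
    · rw [interp_of_mem_of_not ⟨h1, h2⟩ hj]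
      rw [box_of_neg hj] at h3
      omega
  inf_succ_le s h1 h2 := by
    have hi : i < s ∧ s ≤ a := ⟨h1, by omega⟩
    have hi' : i < s + 1 ∧ s + 1 ≤ a := ⟨by omega, h2⟩
    by_cases hj' : j < s + 1 ∧ s + 1 ≤ b
    · rw [interp_of_mem_of_mem hi' hj']
      have hL' := hL (by omega)
      by_cases hj : j < s ∧ s ≤ b
      · rw [interp_of_mem_of_mem hi hj]
        have h3 : L ≤ V s := hL'.mem.2.1.trans (hV (by omega))
        rw [sup_comm (W (s + 1)), sup_comm (W s), inf_comm, sup_inf_assoc_of_le _ h3,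
          inf_comm]
        refine sup_le_sup_left (h.inf_le hW s.le_succ (by omega) ?_) _
        rw [box_of_pos (by omega), box_of_pos (by omega), box_of_pos (by omega),
          box_of_pos (by omega)]
      · rw [interp_of_mem_of_not hi hj]
        have : s = j := by omega
        subst this
        have h3 : W (s + 1) ≤ L := by
          have := hL'.mem.1
          rwa [max_eq_right h1.le] at this
        rw [sup_eq_right.2 h3]
        exact hL'.inf_le_left h1
    · rw [interp_of_mem_of_not hi' hj']
      by_cases hj : j < s ∧ s ≤ b
      · rw [interp_of_mem_of_mem hi hj]
        have : s = b := by omega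
        subst this
        have hL' := hL (by omega)
        -- At `s = b < a` both sides have codimension one in `V b`, so the inclusion supplied by
        -- `le_right` is an equality.
        refine inf_le_of_finrank (le_inf ?_ ?_) ?_
        · exact sup_le (h.1 s) (hL'.mem.2.1.trans (hV (by omega)))
        · exact sup_le (hW s.le_succ) (hL'.le_right (by omega))
        · have h3 := h.finrank_eq s
          have h4 := h.2 s (s + 1) s.le_succ (by omega)
          have h5 := (h.finrank_sup hW hL' (s := s) (by omega) hj).2
          rw [box_of_pos (by omega), box_of_pos (by omega)] at h3
          rw [box_of_pos (by omega), box_of_neg (by omega)] at h4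
          omega
      · rw [interp_of_mem_of_not hi hj]
        refine h.inf_le hW s.le_succ (by omega) ?_
        rw [box_of_pos (by omega), box_of_neg (by omega), box_of_pos (by omega),
          box_of_neg (by omega)]

theorem QuasiSplit.isStep_interp_right (h : QuasiSplit i a j b V W)
    (hW : Monotone W) (hL : max i j < min a b → IsCut i a j b V W L) :
    IsStep j b (interp i a j b V W L) W where
  le s := by
    unfold interp
    split_ifs with hi hj
    · exact le_sup_left
    · exact le_rfl
    · exact h.1 s
  ge s hs := by
    unfold interp
    split_ifs with hi
    · exact le_rfl
    · exact h.le le_rfl (by omega) (by rw [box_of_neg hi, box_of_neg hs])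
  rank s h1 h2 := by
    have h3 := h.finrank_eq s
    by_cases hi : i < s ∧ s ≤ a
    · rw [interp_of_mem_of_mem hi ⟨h1, h2⟩]
      exact (h.finrank_sup hW (hL (by omega)) hi ⟨h1, h2⟩).2
    · rw [interp_of_not hi]
      rw [box_of_neg hi, box_of_pos ⟨h1, h2⟩] at h3
      omega
  inf_succ_le s h1 h2 := by
    by_cases hi : i < s ∧ s ≤ a
    · rw [interp_of_mem_of_mem hi ⟨h1, by omega⟩]
      have hL' := hL (by omega)
      rw [sup_inf_assoc_of_le _ (hW s.le_succ)]
      refine sup_le le_rfl ?_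
      have h3 : W (max i j + 1) ≤ W s := hW (by omega)
      by_cases hi' : s + 1 ≤ a
      · exact (h.finrank_sup hW hL' (s := s + 1) (by omega) (by omega)).1.trans h3
      · have : s = a := by omega
        subst this
        exact (hL'.inf_le_right (by omega)).trans h3
    · rw [interp_of_not hi]
      refine h.inf_le hW s.le_succ (by omega) ?_
      rw [box_of_neg (by omega), box_of_pos (by omega), box_of_neg (by omega),
          box_of_pos (by omega)]

end Interpolation

/-! ### Number of intermediate chains. -/

section Counting

variable {F E : Type*} [Field F] [AddCommGroup E] [Module F E]
  {V U W : ℕ → Submodule F E} {i a j b : ℕ} {L : Submodule F E}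

/-- The chains `U` such that `V → U → W` consists of the steps `(i, a)` and `(j, b)`. -/
def midChains (i a j b : ℕ) (V W : ℕ → Submodule F E) : Set (ℕ → Submodule F E) :=
  {U | Monotone U ∧ IsStep i a V U ∧ IsStep j b U W}

theorem not_le_of_defect {δ : ℕ → ℕ → ℕ} (h : HasDefect V W δ) {r s : ℕ} (hrs : r ≤ s)
    (hδ : 0 < δ r s) : ¬ V r ≤ W s := fun hle => by
  have := h.finrank_inf r s hrs
  rw [inf_eq_left.2 hle] at this
  omega

/-- The hypothesis `S.ncard ≠ 0` encodes finiteness, since infinite sets have `ncard` zero. -/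
theorem ncard_setOf_mem_ne {α : Type*} {S : Set α} (hS : S.ncard ≠ 0) {x : α} (hx : x ∈ S) :
    {L | L ∈ S ∧ L ≠ x}.ncard + 1 = S.ncard := by
  have : {L | L ∈ S ∧ L ≠ x} = S \ {x} := by ext; simp
  rw [this, Set.ncard_sdiff_singleton_of_mem hx]
  omega

/-- The element `x` is excluded for `i < j` and forced for `j < i`; likewise `y` with `a` and `b`.
By `hxy` two exclusions, or two forcings, concern the same element, while an excluded element
differs from a forced one. So at most one element is lost, and a forced one is always admissible. -/
theorem ncard_setOf_cut {α : Type*} {S : Set α} {q : ℕ} (hS : S.ncard = q + 1) {x y : α}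
    (hx : i ≠ j → x ∈ S) (hy : a ≠ b → y ∈ S)
    (hxy : i ≠ j → a ≠ b → (x = y ↔ (i < j ↔ a < b))) :
    {L | L ∈ S ∧ (i < j → L ≠ x) ∧ (j < i → L = x) ∧ (a < b → L ≠ y) ∧ (b < a → L = y)}.ncard =
      if i = j ∧ a = b then q + 1 else if i ≤ j ∧ a ≤ b then q else 1 := by
  have key : ∀ T : Set α, T.ncard = (if i = j ∧ a = b then q + 1 else
      if i ≤ j ∧ a ≤ b then q else 1) → (∀ L, (L ∈ S ∧ (i < j → L ≠ x) ∧ (j < i → L = x) ∧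
        (a < b → L ≠ y) ∧ (b < a → L = y)) ↔ L ∈ T) →
      {L | L ∈ S ∧ (i < j → L ≠ x) ∧ (j < i → L = x) ∧ (a < b → L ≠ y) ∧
        (b < a → L = y)}.ncard = (if i = j ∧ a = b then q + 1 else
      if i ≤ j ∧ a ≤ b then q else 1) := by
    intro T hT hST
    rw [← hT]
    exact congrArg Set.ncard (Set.ext hST)
  have hne : S.ncard ≠ 0 := by omega
  rcases lt_trichotomy i j with hij | hij | hij <;> rcases lt_trichotomy a b with hab | hab | hab
  · have e : x = y := (hxy hij.ne hab.ne).2 (by tauto)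
    have c := ncard_setOf_mem_ne hne (hx hij.ne)
    refine key {L | L ∈ S ∧ L ≠ x} ?_ fun L => ?_
    · rw [if_neg (by omega), if_pos (by omega)]
      omega
    · simp [hij, hab, hij.not_gt, hab.not_gt, ← e]
  · have c := ncard_setOf_mem_ne hne (hx hij.ne)
    refine key {L | L ∈ S ∧ L ≠ x} ?_ fun L => ?_
    · rw [if_neg (by omega), if_pos (by omega)]
      omega
    · simp [hij, hab, hij.not_gt]
  · have e : x ≠ y := fun e => by
      have := (hxy hij.ne hab.ne').1 e
      omega
    have hyS := hy hab.ne'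
    refine key {y} ?_ fun L => ?_
    · rw [if_neg (by omega), if_neg (by omega), Set.ncard_singleton]
    · simp only [hij, hab, hij.not_gt, hab.not_gt, Set.mem_singleton_iff]
      constructor
      · tauto
      · rintro rfl
        exact ⟨hyS, fun _ => e.symm, by tauto, by tauto, by tauto⟩
  · have c := ncard_setOf_mem_ne hne (hy hab.ne)
    refine key {L | L ∈ S ∧ L ≠ y} ?_ fun L => ?_
    · rw [if_neg (by omega), if_pos (by omega)]
      omega
    · simp [hij, hab, hab.not_gt]
  · refine key S ?_ fun L => ?_
    · rw [if_pos (by omega), hS]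
    · simp [hij, hab]
  · have hyS := hy hab.ne'
    refine key {y} ?_ fun L => ?_
    · rw [if_neg (by omega), if_neg (by omega), Set.ncard_singleton]
    · simp only [hij, hab, hab.not_gt, Set.mem_singleton_iff]
      constructor
      · tauto
      · rintro rfl
        exact ⟨hyS, by simp, by simp, by simp, by simp⟩
  all_goals
    have hxS := hx hij.ne'
    refine key {x} ?_ fun L => ?_
    · rw [if_neg (by omega), if_neg (by omega), Set.ncard_singleton]
    · simp only [hij, hij.not_gt, Set.mem_singleton_iff]
      constructor
      · tauto
      · rintro rfl
        refine ⟨hxS, by simp, by simp, fun h => ?_, fun h => ?_⟩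
        · intro e
          have := (hxy hij.ne' h.ne).1 e
          omega
        · exact (hxy hij.ne' h.ne').2 (by omega)

/-- This is the line of vectors that become zero in `V/W` just after the shorter-lived interval
ends. -/
theorem QuasiSplit.right_mem_lines (h : QuasiSplit i a j b V W) (hW : Monotone W)
    (hov : max i j < min a b) (hab : a ≠ b) :
    V (max i j + 1) ⊓ W (min a b + 1) ∈ lines (W (max i j + 1)) (V (max i j + 1)) := by
  refine ⟨le_inf (h.1 _) (hW (by omega)), inf_le_left, ?_⟩
  have h1 := h.finrank_eq (max i j + 1)
  have h2 := h.2 (max i j + 1) (min a b + 1) (by omega) (by omega)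
  rw [box_of_pos (by omega), box_of_pos (by omega)] at h1
  rcases hab.lt_or_gt with hlt | hlt
  · rw [box_of_neg (by omega), box_of_pos (by omega)] at h2
    omega
  · rw [box_of_pos (by omega), box_of_neg (by omega)] at h2
    omega

variable [FiniteDimensional F E]

theorem QuasiSplit.ncard_midChains_of_le (h : QuasiSplit i a j b V W) (hV : Monotone V)
    (hW : Monotone W) (hov : min a b ≤ max i j) : (midChains i a j b V W).ncard = 1 := by
  have hL : max i j < min a b → IsCut i a j b V W ⊥ := fun h' => absurd hov h'.not_ge
  rw [Set.ncard_eq_one]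
  refine ⟨interp i a j b V W ⊥, Set.eq_singleton_iff_unique_mem.2 ⟨⟨h.monotone_interp hV hW hL,
    h.isStep_interp_left hV hW hL, h.isStep_interp_right hW hL⟩, ?_⟩⟩
  rintro U ⟨hU, h₁, h₂⟩
  rw [h₁.eq_interp h₂ hU]
  funext s
  unfold interp
  split_ifs with hi hj
  · omega
  · rfl
  · rfl

theorem QuasiSplit.ncard_midChains_of_lt (h : QuasiSplit i a j b V W) (hV : Monotone V)
    (hW : Monotone W) (hov : max i j < min a b) :
    (midChains i a j b V W).ncard = {L | IsCut i a j b V W L}.ncard := by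
  refine Set.ncard_congr (fun U _ => U (max i j + 1)) ?_ ?_ ?_
  · rintro U ⟨hU, h₁, h₂⟩
    exact h₁.isCut h₂ hU hov
  · rintro U U' ⟨hU, h₁, h₂⟩ ⟨hU', h₁', h₂'⟩ he
    rw [h₁.eq_interp h₂ hU, h₁'.eq_interp h₂' hU']
    exact congrArg _ he
  · intro L hL
    refine ⟨interp i a j b V W L, ⟨h.monotone_interp hV hW fun _ => hL,
      h.isStep_interp_left hV hW fun _ => hL, h.isStep_interp_right hW fun _ => hL⟩, ?_⟩
    rw [interp_of_mem_of_mem (by omega) (by omega), sup_eq_right.2 hL.mem.1]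

/-- This is the line that arrives from the interval with the earlier start. -/
theorem QuasiSplit.left_mem_lines (h : QuasiSplit i a j b V W) (hV : Monotone V)
    (hov : max i j < min a b) (hij : i ≠ j) :
    W (max i j + 1) ⊔ V (max i j) ∈ lines (W (max i j + 1)) (V (max i j + 1)) := by
  refine ⟨le_sup_left, sup_le (h.1 _) (hV (Nat.le_succ _)), ?_⟩
  have h1 := Submodule.finrank_sup_add_finrank_inf_eq (V (max i j)) (W (max i j + 1))
  have h2 := h.2 (max i j) (max i j + 1) (Nat.le_succ _) (by omega)
  rw [sup_comm]
  rcases hij.lt_or_gt with hlt | hlt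
  · rw [box_of_pos (by omega), box_of_neg (by omega)] at h2
    omega
  · rw [box_of_neg (by omega), box_of_pos (by omega)] at h2
    omega

/-- Each cut condition compares `L` with one distinguished line. An inclusion between lines is an
equality, and an intersection larger than the prescribed one forces such an inclusion because the
relevant codimension is one. -/
theorem QuasiSplit.isCut_iff (h : QuasiSplit i a j b V W) (hV : Monotone V) (hW : Monotone W)
    (hov : max i j < min a b) :
    IsCut i a j b V W L ↔ L ∈ lines (W (max i j + 1)) (V (max i j + 1)) ∧
      (i < j → L ≠ W (max i j + 1) ⊔ V (max i j)) ∧ (j < i → L = W (max i j + 1) ⊔ V (max i j)) ∧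
      (a < b → L ≠ V (max i j + 1) ⊓ W (min a b + 1)) ∧
      (b < a → L = V (max i j + 1) ⊓ W (min a b + 1)) := by
  constructor
  · intro hL
    refine ⟨hL.mem, fun hlt he => ?_, fun hlt => ?_, fun hlt he => ?_, fun hlt => ?_⟩
    · have h1 := hL.inf_le_left hlt
      have h2 : V j ≤ L := by
        rw [he, max_eq_right hlt.le]
        exact le_sup_right
      rw [inf_eq_left.2 h2] at h1
      have h3 := Submodule.finrank_mono h1
      have h4 := h.finrank_eq j
      rw [box_of_pos (by omega)] at h4
      omega
    · refine (lines_eq_of_le (h.left_mem_lines hV hov hlt.ne') hL.mem (sup_le hL.mem.1 ?_)).symm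
      rw [max_eq_left hlt.le]
      exact hL.le_left hlt
    · have h1 := hL.inf_le_right hlt
      have h2 : L ≤ W (a + 1) := by
        rw [he, min_eq_left hlt.le]
        exact inf_le_right
      rw [inf_eq_left.2 h2] at h1
      have h3 := Submodule.finrank_mono h1
      have h4 := hL.mem.2.2
      omega
    · refine lines_eq_of_le hL.mem (h.right_mem_lines hW hov hlt.ne') (le_inf hL.mem.2.1 ?_)
      rw [min_eq_right hlt.le]
      exact hL.le_right hlt
  · rintro ⟨h0, h1, h2, h3, h4⟩
    refine ⟨h0, fun hlt => ?_, fun hlt => ?_, fun hlt => ?_, fun hlt => ?_⟩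
    · by_contra hc
      refine h1 hlt (lines_eq_of_le (h.left_mem_lines hV hov hlt.ne) h0 (sup_le h0.1 ?_)).symm
      rw [max_eq_right hlt.le]
      have hle : W j ≤ V j ⊓ L := by
        refine le_inf (h.1 j) (le_trans ?_ h0.1)
        exact hW (by omega)
      have h5 := Submodule.finrank_lt_finrank_of_lt (lt_of_le_not_ge hle hc)
      have h6 := h.finrank_eq j
      rw [box_of_pos (by omega), box_of_neg (by omega)] at h6
      have h7 : finrank F ↥(V j ⊓ L) ≤ finrank F (V j) := Submodule.finrank_mono inf_le_left
      exact le_of_finrank_inf (by omega)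
    · rw [h2 hlt]
      refine le_trans (hV ?_) le_sup_right
      omega
    · by_contra hc
      refine h3 hlt (lines_eq_of_le h0 (h.right_mem_lines hW hov hlt.ne) (le_inf h0.2.1 ?_))
      rw [min_eq_left hlt.le]
      have hle : W (max i j + 1) ≤ L ⊓ W (a + 1) := le_inf h0.1 (hW (by omega))
      have h5 := Submodule.finrank_lt_finrank_of_lt (lt_of_le_not_ge hle hc)
      have h6 := h0.2.2
      have h7 : finrank F ↥(L ⊓ W (a + 1)) ≤ finrank F L := Submodule.finrank_mono inf_le_left
      exact le_of_finrank_inf (by omega)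
    · rw [h4 hlt]
      refine le_trans inf_le_right (hW ?_)
      omega

theorem QuasiSplit.ncard_lines [Finite F] (h : QuasiSplit i a j b V W)
    (hov : max i j < min a b) :
    (lines (W (max i j + 1)) (V (max i j + 1))).ncard = Nat.card F + 1 := by
  refine BLM.ncard_lines (h.1 _) ?_
  have h1 := h.finrank_eq (max i j + 1)
  rw [box_of_pos (by omega), box_of_pos (by omega)] at h1
  omega

theorem QuasiSplit.left_eq_right_iff (h : QuasiSplit i a j b V W) (hV : Monotone V)
    (hW : Monotone W) (hov : max i j < min a b) (hij : i ≠ j) (hab : a ≠ b) :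
    W (max i j + 1) ⊔ V (max i j) = V (max i j + 1) ⊓ W (min a b + 1) ↔
      V (max i j) ≤ W (min a b + 1) := by
  constructor
  · exact fun he => le_sup_right.trans (he.le.trans inf_le_right)
  · exact fun hle => lines_eq_of_le (h.left_mem_lines hV hov hij) (h.right_mem_lines hW hov hab)
      (sup_le (le_inf (h.1 _) (hW (by omega))) (le_inf (hV (Nat.le_succ _)) hle))

/-- In the split case the two distinguished lines coincide exactly when the defect at `(max i j, min
a b + 1)` vanishes, that is when the starts and the ends of the intervals are ordered in the same
way. This is the hypothesis `hxy` of `ncard_setOf_cut`. -/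
theorem HasDefect.ncard_midChains [Finite F]
    (hd : HasDefect V W (fun r s => box i a r s + box j b r s))
    (hV : Monotone V) (hW : Monotone W) :
    (midChains i a j b V W).ncard =
      if i = j ∧ a = b ∧ i < a then Nat.card F + 1
      else if i ≤ j ∧ j < a ∧ a ≤ b then Nat.card F else 1 := by
  have h := hd.quasiSplit
  by_cases hov : max i j < min a b
  swap
  · rw [h.ncard_midChains_of_le hV hW (not_lt.1 hov), if_neg (by omega), if_neg (by omega)]
  have hc := h.ncard_lines hov
  rw [h.ncard_midChains_of_lt hV hW hov]
  simp only [h.isCut_iff hV hW hov]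
  have hb := hd.finrank_inf (max i j) (min a b + 1) (by omega)
  rw [ncard_setOf_cut hc (h.left_mem_lines hV hov) (h.right_mem_lines hW hov) fun hij hab => ?_]
  · split_ifs <;> first | rfl | omega
  rw [h.left_eq_right_iff hV hW hov hij hab]
  constructor
  · intro hle
    by_contra hcon
    refine not_le_of_defect hd (by omega) ?_ hle
    rcases hij.lt_or_gt with hlt | hlt
    · rw [box_of_pos (by omega)]
      omega
    · rw [box_of_neg (by omega), box_of_pos (by omega)]
      omega
  · intro hiff
    refine le_of_finrank_inf ?_
    rw [box_of_neg (by omega), box_of_neg (by omega)] at hb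
    exact hb

/-- In the nonsplit case the two distinguished lines differ and both are excluded, which leaves `q +
1 - 2` lines. For `j = a` there is no overlap and nothing to choose. -/
theorem HasDefect.ncard_midChains_of_lt [Finite F]
    (hd : HasDefect V W (fun r s => box i b r s + box j a r s)) (hc : i < j ∧ j ≤ a ∧ a < b)
    (hV : Monotone V) (hW : Monotone W) :
    (midChains i a j b V W).ncard = if j < a then Nat.card F - 1 else 1 := by
  have h := hd.quasiSplit_of_lt hc
  by_cases hov : max i j < min a b
  swap
  · rw [h.ncard_midChains_of_le hV hW (not_lt.1 hov), if_neg (by omega)]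
  have hl := h.ncard_lines hov
  rw [h.ncard_midChains_of_lt hV hW hov]
  simp only [h.isCut_iff hV hW hov]
  have h1 := h.left_mem_lines hV hov (by omega)
  have h2 := h.right_mem_lines hW hov (by omega)
  have h3 : W (max i j + 1) ⊔ V (max i j) ≠ V (max i j + 1) ⊓ W (min a b + 1) := by
    rw [Ne, h.left_eq_right_iff hV hW hov (by omega) (by omega)]
    refine not_le_of_defect hd (by omega) ?_
    rw [box_of_pos (by omega)]
    omega
  have hS : ∀ L, (L ∈ lines (W (max i j + 1)) (V (max i j + 1)) ∧
      (i < j → L ≠ W (max i j + 1) ⊔ V (max i j)) ∧ (j < i → L = W (max i j + 1) ⊔ V (max i j)) ∧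
      (a < b → L ≠ V (max i j + 1) ⊓ W (min a b + 1)) ∧
      (b < a → L = V (max i j + 1) ⊓ W (min a b + 1))) ↔
      L ∈ {L | L ∈ lines (W (max i j + 1)) (V (max i j + 1)) ∧
        L ≠ W (max i j + 1) ⊔ V (max i j)} ∧ L ≠ V (max i j + 1) ⊓ W (min a b + 1) := by
    intro L
    have e1 := hc.1
    have e2 := hc.2.2
    have e3 := hc.1.not_gt
    have e4 := hc.2.2.not_gt
    simp only [Set.mem_ofPred_eq]
    tauto
  simp only [hS]
  have hF : 1 < Nat.card F := Finite.one_lt_card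
  have c1 := ncard_setOf_mem_ne (by omega) h1
  have c2 := ncard_setOf_mem_ne (S := {L | L ∈ lines (W (max i j + 1)) (V (max i j + 1)) ∧
    L ≠ W (max i j + 1) ⊔ V (max i j)}) (by omega) ⟨h2, h3.symm⟩
  rw [if_pos (by omega)]
  omega

end Counting

/-! ### Relative position and dimensions of intersections -/

section RelPos

variable {F : Type} [Field F] {n d : ℕ}

/-- A flag as a chain indexed by all natural numbers, constant from `n` on. -/
def Flag.chain (V : Flag F n d) (s : ℕ) : Submodule F (Fin d → F) :=
  V.space ⟨min s n, by omega⟩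

theorem Flag.chain_monotone (V : Flag F n d) : Monotone V.chain := by
  intro r s hrs
  exact Fin.monotone_iff_le_succ.2 V.le_succ (Fin.mk_le_mk.2 (by omega))

theorem Flag.chain_zero (V : Flag F n d) : V.chain 0 = ⊥ := by
  rw [← V.space_zero]
  exact congrArg V.space (Fin.ext (by simp))

theorem Flag.chain_of_le (V : Flag F n d) {s : ℕ} (hs : n ≤ s) : V.chain s = ⊤ := by
  rw [← V.space_last]
  exact congrArg V.space (Fin.ext (by simpa using hs))

theorem Flag.chain_min (V : Flag F n d) (s : ℕ) : V.chain (min s n) = V.chain s :=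
  congrArg V.space (Fin.ext (by simp))

theorem Flag.chain_castSucc (V : Flag F n d) (i : Fin n) : V.chain i = V.space i.castSucc :=
  congrArg V.space (Fin.ext (by simp))

theorem Flag.chain_succ (V : Flag F n d) (i : Fin n) : V.chain (i + 1) = V.space i.succ :=
  congrArg V.space (Fin.ext (by simp))

theorem Flag.chain_injective : Function.Injective (Flag.chain : Flag F n d → _) := by
  intro V W h
  have : V.space = W.space := by
    funext s
    have h1 := congrFun h s
    have h2 : ∀ U : Flag F n d, U.chain s = U.space s := fun U =>
      congrArg U.space (Fin.ext (by simp; omega))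
    rwa [h2, h2] at h1
  cases V
  cases W
  cases this
  rfl

theorem finrank_quotient_submoduleOf {E : Type*} [AddCommGroup E] [Module F E]
    [FiniteDimensional F E] {X Y : Submodule F E} (h : X ≤ Y) :
    finrank F (Y ⧸ X.submoduleOf Y) + finrank F X = finrank F Y := by
  rw [← Submodule.finrank_quotient_add_finrank (X.submoduleOf Y),
    ← Submodule.finrank_map_subtype_eq Y (X.submoduleOf Y), Submodule.submoduleOf,
    Submodule.map_comap_subtype, inf_eq_right.2 h]

/-- The entries of the relative position are the mixed second differences of `dim (V_r ∩ W_s)`, by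
two applications of the dimension formula for a sum. -/
theorem relPos_add (V W : Flag F n d) (i j : Fin n) :
    relPos V W i j + finrank F ↥(V.chain i ⊓ W.chain (j + 1)) +
        finrank F ↥(V.chain (i + 1) ⊓ W.chain j) =
      finrank F ↥(V.chain (i + 1) ⊓ W.chain (j + 1)) + finrank F ↥(V.chain i ⊓ W.chain j) := by
  have hV : V.chain i ≤ V.chain (i + 1) := V.chain_monotone (Nat.le_succ _)
  have hW : W.chain j ≤ W.chain (j + 1) := W.chain_monotone (Nat.le_succ _)
  have h0 : relPos V W i j + finrank F ↥(V.chain i ⊔ V.chain (i + 1) ⊓ W.chain j) =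
      finrank F ↥(V.chain i ⊔ V.chain (i + 1) ⊓ W.chain (j + 1)) := by
    have h := finrank_quotient_submoduleOf
      (sup_le_sup_left (inf_le_inf_left (V.chain (i + 1)) hW) (V.chain i))
    rw [V.chain_castSucc, W.chain_castSucc, V.chain_succ, W.chain_succ] at h ⊢
    exact h
  have h1 := Submodule.finrank_sup_add_finrank_inf_eq (V.chain i) (V.chain (i + 1) ⊓ W.chain j)
  have h2 := Submodule.finrank_sup_add_finrank_inf_eq (V.chain i)
    (V.chain (i + 1) ⊓ W.chain (j + 1))
  rw [← inf_assoc, inf_eq_left.2 hV] at h1 h2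
  omega

/-- The sum of the entries in the first `r` rows and the first `s` columns. -/
def cornerSum (C : Matrix (Fin n) (Fin n) ℕ) (r s : ℕ) : ℕ :=
  ∑ k : Fin n, ∑ l : Fin n, if (k : ℕ) < r ∧ (l : ℕ) < s then C k l else 0

theorem cornerSum_add (C D : Matrix (Fin n) (Fin n) ℕ) (r s : ℕ) :
    cornerSum (C + D) r s = cornerSum C r s + cornerSum D r s := by
  simp only [cornerSum, ← Finset.sum_add_distrib]
  refine Finset.sum_congr rfl fun k _ => Finset.sum_congr rfl fun l _ => ?_
  split_ifs <;> simp

theorem cornerSum_min (C : Matrix (Fin n) (Fin n) ℕ) (r s : ℕ) :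
    cornerSum C (min r n) (min s n) = cornerSum C r s := by
  refine Finset.sum_congr rfl fun k _ => Finset.sum_congr rfl fun l _ => if_congr ?_ rfl rfl
  omega

theorem cornerSum_single (i a : Fin n) (r s : ℕ) :
    cornerSum (Matrix.single i a 1) r s = if (i : ℕ) < r ∧ (a : ℕ) < s then 1 else 0 := by
  rw [cornerSum, Finset.sum_eq_single i, Finset.sum_eq_single a]
  · simp
  · intro l _ hl
    simp [hl.symm]
  · simp
  · intro k _ hk
    simp [hk.symm]
  · simp

/-- The sum of the first `s` entries of a vector. -/
def prefixSum (ν : Fin n → ℕ) (s : ℕ) : ℕ := ∑ k : Fin n, if (k : ℕ) < s then ν k else 0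

theorem cornerSum_diagonal (ν : Fin n → ℕ) (r s : ℕ) :
    cornerSum (Matrix.diagonal ν) r s = prefixSum ν (min r s) := by
  refine Finset.sum_congr rfl fun k _ => ?_
  rw [Finset.sum_eq_single k]
  · simp
  · intro l _ hl
    simp [Matrix.diagonal_apply_ne _ hl.symm]
  · simp

theorem prefixSum_min (ν : Fin n → ℕ) (s : ℕ) : prefixSum ν (min s n) = prefixSum ν s := by
  refine Finset.sum_congr rfl fun k _ => if_congr ?_ rfl rfl
  omega

theorem cornerSum_rec (C : Matrix (Fin n) (Fin n) ℕ) (i j : Fin n) :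
    C i j + cornerSum C i (j + 1) + cornerSum C (i + 1) j =
      cornerSum C (i + 1) (j + 1) + cornerSum C i j := by
  have h : C i j = ∑ k, ∑ l, if k = i ∧ l = j then C k l else 0 := by
    rw [Finset.sum_eq_single i, Finset.sum_eq_single j]
    · simp
    · intro l _ hl
      simp [hl]
    · simp
    · intro k _ hk
      simp [hk]
    · simp
  rw [h]
  simp only [cornerSum, ← Finset.sum_add_distrib]
  refine Finset.sum_congr rfl fun k _ => Finset.sum_congr rfl fun l _ => ?_
  simp only [Fin.ext_iff]
  split_ifs <;> omega

theorem cornerSum_zero_left (C : Matrix (Fin n) (Fin n) ℕ) (s : ℕ) : cornerSum C 0 s = 0 := by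
  simp [cornerSum]

theorem cornerSum_zero_right (C : Matrix (Fin n) (Fin n) ℕ) (r : ℕ) : cornerSum C r 0 = 0 := by
  simp [cornerSum]

/-- Corner sums and dimensions of intersections obey the same recursion with zero boundary values,
so either family determines the other. -/
theorem relPos_eq_iff (V W : Flag F n d) (C : Matrix (Fin n) (Fin n) ℕ) :
    relPos V W = C ↔ ∀ r s, finrank F ↥(V.chain r ⊓ W.chain s) = cornerSum C r s := by
  constructor
  · rintro rfl
    have key : ∀ r, r ≤ n → ∀ s, s ≤ n →
        finrank F ↥(V.chain r ⊓ W.chain s) = cornerSum (relPos V W) r s := by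
      intro r
      induction r with
      | zero =>
        intro _ s _
        rw [V.chain_zero, bot_inf_eq, finrank_bot, cornerSum_zero_left]
      | succ r ihr =>
        intro hr s
        induction s with
        | zero =>
          intro _
          rw [W.chain_zero, inf_bot_eq, finrank_bot, cornerSum_zero_right]
        | succ s ihs =>
          intro hs
          have h1 := relPos_add V W ⟨r, hr⟩ ⟨s, hs⟩
          have h2 := cornerSum_rec (relPos V W) ⟨r, hr⟩ ⟨s, hs⟩
          have h3 := ihr (by omega) (s + 1) hs
          have h4 := ihr (by omega) s (by omega)
          have h5 := ihs (by omega)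
          simp only at h1 h2
          omega
    intro r s
    rw [← V.chain_min, ← W.chain_min, key _ (by omega) _ (by omega), cornerSum_min]
  · intro h
    ext i j
    have h1 := relPos_add V W i j
    have h2 := cornerSum_rec C i j
    simp only [h] at h1
    omega

/-- The matrix `E_{ia} + E_{jb} + diag ν`. -/
def quad {R : Type*} [Semiring R] (i a j b : Fin n) (ν : Fin n → R) : Matrix (Fin n) (Fin n) R :=
  Matrix.single i a 1 + Matrix.single j b 1 + Matrix.diagonal ν

theorem cornerSum_quad (i a j b : Fin n) (ν : Fin n → ℕ) (r s : ℕ) :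
    cornerSum (quad i a j b ν) r s = (if (i : ℕ) < r ∧ (a : ℕ) < s then 1 else 0) +
      (if (j : ℕ) < r ∧ (b : ℕ) < s then 1 else 0) + prefixSum ν (min r s) := by
  rw [quad, cornerSum_add, cornerSum_add, cornerSum_single, cornerSum_single, cornerSum_diagonal]

/-- The dimensions in a flag whose graded pieces have dimensions `e_i + e_j + ν`. -/
def HasDims (V : ℕ → Submodule F (Fin d → F)) (i j : Fin n) (ν : Fin n → ℕ) : Prop :=
  ∀ s, finrank F (V s) =
    (if (i : ℕ) < s then 1 else 0) + (if (j : ℕ) < s then 1 else 0) + prefixSum ν s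

/-- Since the matrix is upper triangular, its corner sums at `(n, s)` and `(s, s)` agree, which
means `W s ≤ V s`. The intersections with `r ≥ s` then carry no information. -/
theorem relPos_eq_quad_iff (V W : Flag F n d) {i a j b : Fin n} (hia : i ≤ a) (hjb : j ≤ b)
    (ν : Fin n → ℕ) : relPos V W = quad i a j b ν ↔ HasDims V.chain i j ν ∧
      HasDefect V.chain W.chain (fun r s => box i a r s + box j b r s) := by
  rw [relPos_eq_iff]
  simp only [cornerSum_quad]
  rw [Fin.le_def] at hia hjb
  constructor
  · intro h
    have hV : HasDims V.chain i j ν := fun s => by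
      have h1 := h s n
      rw [W.chain_of_le le_rfl, inf_top_eq, prefixSum_min] at h1
      rw [h1]
      simp
    refine ⟨hV, fun s => ?_, fun r s hrs => ?_⟩
    · have h1 := h n s
      have h2 := h s s
      rw [V.chain_of_le le_rfl, top_inf_eq, min_comm, prefixSum_min] at h1
      rw [min_self] at h2
      rw [← inf_eq_right]
      refine Submodule.eq_of_le_of_finrank_eq inf_le_right ?_
      rw [h1, h2]
      congr 2 <;> exact if_congr (by omega) rfl rfl
    · rw [h, hV, min_eq_left hrs]
      simp only [box]
      split_ifs <;> omega
  · rintro ⟨hV, hd⟩ r s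
    have key : ∀ r s, r ≤ s → finrank F ↥(V.chain r ⊓ W.chain s) =
        (if (i : ℕ) < r ∧ (a : ℕ) < s then 1 else 0) +
        (if (j : ℕ) < r ∧ (b : ℕ) < s then 1 else 0) + prefixSum ν r := fun r s hrs => by
      have h1 := hd.finrank_inf r s hrs
      rw [hV] at h1
      simp only [box] at h1
      revert h1
      split_ifs <;> omega
    rcases le_total r s with hrs | hrs
    · rw [key r s hrs, min_eq_left hrs]
    · have h1 : V.chain r ⊓ W.chain s = V.chain s ⊓ W.chain s := by
        rw [inf_eq_right.2 (hd.le s), inf_eq_right.2 ((hd.le s).trans (V.chain_monotone hrs))]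
      rw [h1, key s s le_rfl, min_eq_right hrs]
      congr 2 <;> exact if_congr (by omega) rfl rfl

theorem HasDefect.congr {E : Type*} [AddCommGroup E] [Module F E] {V W : ℕ → Submodule F E}
    {δ δ' : ℕ → ℕ → ℕ} (h : HasDefect V W δ) (hδ : ∀ r s, r ≤ s → δ r s = δ' r s) :
    HasDefect V W δ' :=
  ⟨h.le, fun r s hrs => by rw [← hδ r s hrs, h.finrank_inf r s hrs]⟩

theorem relPos_eq_step_iff (V W : Flag F n d) {i a : Fin n} (hia : i ≤ a) (j : Fin n)
    (ν : Fin n → ℕ) : relPos V W = quad i a j j ν ↔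
      HasDims V.chain i j ν ∧ IsStep i a V.chain W.chain := by
  rw [relPos_eq_quad_iff V W hia le_rfl, isStep_iff V.chain_monotone W.chain_monotone]
  have : ∀ r s, r ≤ s → box i a r s + box j j r s = box i a r s := fun r s hrs => by
    rw [box_of_neg (k := j) (by omega), add_zero]
  exact and_congr_right fun _ =>
    ⟨fun h => h.congr this, fun h => h.congr fun r s hrs => (this r s hrs).symm⟩

/-- The step moves one dimension from the graded piece `i` to the graded piece `a`. The row sums
required for the second step thus hold automatically. -/
theorem HasDims.of_isStep {V U : ℕ → Submodule F (Fin d → F)} {i a j : Fin n} {ν : Fin n → ℕ}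
    (hV : HasDims V i j ν) (hia : i ≤ a) (h : IsStep i a V U) : HasDims U j a ν := fun s => by
  have h1 := hV s
  rw [Fin.le_def] at hia
  by_cases hs : (i : ℕ) < s ∧ s ≤ a
  · have h2 := h.rank s hs.1 hs.2
    rw [if_pos hs.1] at h1
    rw [if_neg (by omega : ¬ (a : ℕ) < s)]
    omega
  · rw [← h.eq hs, h1]
    split_ifs <;> omega

/-- A monotone chain with `U 0 = ⊥` and `U n = ⊤`, as a flag. -/
def Flag.ofChain (U : ℕ → Submodule F (Fin d → F)) (hU : Monotone U) (h0 : U 0 = ⊥)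
    (hn : U n = ⊤) : Flag F n d where
  space s := U s
  le_succ i := hU (by simp)
  space_zero := h0
  space_last := hn

theorem card_midFlags (V W : Flag F n d) {i a j b : Fin n} (hia : i ≤ a) (hjb : j ≤ b)
    {ν : Fin n → ℕ} (hV : HasDims V.chain i j ν) :
    Nat.card {U : Flag F n d // relPos V U = quad i a j j ν ∧ relPos U W = quad j b a a ν} =
      (midChains i a j b V.chain W.chain).ncard := by
  rw [← Nat.card_coe_set_eq]
  refine Nat.card_eq_of_bijective (fun U => ⟨U.1.chain, U.1.chain_monotone,
    ((relPos_eq_step_iff V U.1 hia j ν).1 U.2.1).2,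
    ((relPos_eq_step_iff U.1 W hjb a ν).1 U.2.2).2⟩) ⟨?_, ?_⟩
  · intro U U' h
    exact Subtype.ext (Flag.chain_injective (congrArg Subtype.val h))
  · rintro ⟨U, hU, h₁, h₂⟩
    -- Since `a < n`, the first step changes neither index `0` nor any index from `n` on, so the
    -- intermediate chain is a flag.
    have htop : ∀ s, n ≤ s → U s = ⊤ := fun s hs => by
      rw [← h₁.eq (by omega), V.chain_of_le hs]
    let U' : Flag F n d := Flag.ofChain U hU (by rw [← h₁.eq (by omega), V.chain_zero])
      (htop n le_rfl)
    have hU' : U'.chain = U := by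
      funext s
      change U (min s n) = U s
      rcases le_total s n with h | h
      · rw [min_eq_left h]
      · rw [min_eq_right h, htop n le_rfl, htop s h]
    refine ⟨⟨U', (relPos_eq_step_iff V U' hia j ν).2 ⟨hV, hU'.symm ▸ h₁⟩,
      (relPos_eq_step_iff U' W hjb a ν).2 ⟨hU'.symm ▸ hV.of_isStep hia h₁, hU'.symm ▸ h₂⟩⟩,
      Subtype.ext hU'⟩

open Classical in
theorem card_midFlags_eq [Finite F] (V W : Flag F n d) {i a j b : Fin n} (hia : i ≤ a)
    (hjb : j ≤ b) (ν : Fin n → ℕ) :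
    Nat.card {U : Flag F n d // relPos V U = quad i a j j ν ∧ relPos U W = quad j b a a ν} =
      if relPos V W = quad i a j b ν then
        if i = j ∧ a = b ∧ i < a then Nat.card F + 1
        else if i ≤ j ∧ j < a ∧ a ≤ b then Nat.card F else 1
      else if (i < j ∧ j ≤ a ∧ a < b) ∧ relPos V W = quad i b j a ν then
        if j < a then Nat.card F - 1 else 1
      else 0 := by
  split_ifs with h1 h2 h3 h4 h5
  · obtain ⟨hV, hd⟩ := (relPos_eq_quad_iff V W hia hjb ν).1 h1
    rw [card_midFlags V W hia hjb hV, hd.ncard_midChains V.chain_monotone W.chain_monotone,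
      if_pos (by simpa [Fin.ext_iff] using h2)]
  · obtain ⟨hV, hd⟩ := (relPos_eq_quad_iff V W hia hjb ν).1 h1
    rw [card_midFlags V W hia hjb hV, hd.ncard_midChains V.chain_monotone W.chain_monotone,
      if_neg (by simpa [Fin.ext_iff] using h2), if_pos (by simpa using h3)]
  · obtain ⟨hV, hd⟩ := (relPos_eq_quad_iff V W hia hjb ν).1 h1
    rw [card_midFlags V W hia hjb hV, hd.ncard_midChains V.chain_monotone W.chain_monotone,
      if_neg (by simpa [Fin.ext_iff] using h2), if_neg (by simpa using h3)]
  · obtain ⟨hlt, h4⟩ := h4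
    obtain ⟨hV, hd⟩ := (relPos_eq_quad_iff V W (hia.trans hlt.2.2.le) hlt.2.1 ν).1 h4
    rw [card_midFlags V W hia hjb hV,
      hd.ncard_midChains_of_lt (by simpa using hlt) V.chain_monotone W.chain_monotone,
      if_pos (by simpa using h5)]
  · obtain ⟨hlt, h4⟩ := h4
    obtain ⟨hV, hd⟩ := (relPos_eq_quad_iff V W (hia.trans hlt.2.2.le) hlt.2.1 ν).1 h4
    rw [card_midFlags V W hia hjb hV,
      hd.ncard_midChains_of_lt (by simpa using hlt) V.chain_monotone W.chain_monotone,
      if_neg (by simpa using h5)]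
  · rw [Nat.card_eq_zero]
    left
    refine ⟨fun ⟨U, hU₁, hU₂⟩ => ?_⟩
    obtain ⟨hV, s₁⟩ := (relPos_eq_step_iff V U hia j ν).1 hU₁
    obtain ⟨-, s₂⟩ := (relPos_eq_step_iff U W hjb a ν).1 hU₂
    rcases s₁.comp s₂ V.chain_monotone U.chain_monotone W.chain_monotone with hd | ⟨hlt, hd⟩
    · exact h1 ((relPos_eq_quad_iff V W hia hjb ν).2 ⟨hV, hd⟩)
    · have hlt' : i < j ∧ j ≤ a ∧ a < b := by simpa using hlt
      exact h4 ⟨hlt',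
        (relPos_eq_quad_iff V W (hia.trans hlt'.2.2.le) hlt'.2.1 ν).2 ⟨hV, hd⟩⟩

end RelPos

/-! ### Counting polynomials -/

section CoordinateFlags

variable (F : Type) [Field F] {n d : ℕ}

/-- The subspace of `F ^ d` spanned by the standard basis vectors with index in `S`. -/
def coordSpan (S : Set (Fin d)) : Submodule F (Fin d → F) :=
  Submodule.span F (Pi.basisFun F (Fin d) '' S)

theorem coordSpan_inf (S T : Set (Fin d)) :
    coordSpan F S ⊓ coordSpan F T = coordSpan F (S ∩ T) := by
  ext x
  simp only [coordSpan, Submodule.mem_inf, Basis.mem_span_image, Set.subset_inter_iff]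

theorem finrank_coordSpan (S : Set (Fin d)) : finrank F (coordSpan F S) = Nat.card S := by
  classical
  have : LinearIndependent F fun t : S => Pi.basisFun F (Fin d) t :=
    (Pi.basisFun F (Fin d)).linearIndependent.comp _ Subtype.val_injective
  rw [coordSpan, Set.image_eq_range, finrank_span_eq_card this, Nat.card_eq_fintype_card]

/-- The flag spanned by coordinate vectors of weight below the step. -/
def coordFlag (w : Fin d → Fin n) : Flag F n d where
  space s := coordSpan F {t | (w t : ℕ) < s}
  le_succ i := Submodule.span_mono (Set.image_mono fun t ht =>
    lt_trans (b := (i : ℕ)) ht (Nat.lt_succ_self _))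
  space_zero := by simp [coordSpan]
  space_last := by
    have : {t : Fin d | (w t : ℕ) < (Fin.last n : Fin (n + 1))} = Set.univ :=
      Set.eq_univ_of_forall fun t => (w t).2
    rw [this, coordSpan, Set.image_univ, Basis.span_eq]

theorem coordFlag_chain (w : Fin d → Fin n) (s : ℕ) :
    (coordFlag F w).chain s = coordSpan F {t | (w t : ℕ) < s} := by
  change coordSpan F {t | (w t : ℕ) < min s n} = _
  refine congrArg (coordSpan F) (Set.ext fun t => ?_)
  have := (w t).2
  change (w t : ℕ) < min s n ↔ (w t : ℕ) < s
  omega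

/-- The basis vectors are labelled by pairs `(k, l)`, each used `C k l` times, and the two
coordinate flags are filtered by the two components of the label. -/
theorem exists_relPos_eq (C : Theta n d) : ∃ V W : Flag F n d, relPos V W = C.1 := by
  have hcard : Fintype.card (Σ p : Fin n × Fin n, Fin (C.1 p.1 p.2)) = Fintype.card (Fin d) := by
    rw [Fintype.card_sigma, Fintype.card_fin, Fintype.sum_prod_type]
    simpa using C.2
  let e := Fintype.equivOfCardEq hcard
  refine ⟨coordFlag F fun t => (e.symm t).1.1, coordFlag F fun t => (e.symm t).1.2, ?_⟩
  rw [relPos_eq_iff]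
  intro r s
  rw [coordFlag_chain, coordFlag_chain, coordSpan_inf, finrank_coordSpan]
  have : Nat.card ({t | ((e.symm t).1.1 : ℕ) < r} ∩ {t | ((e.symm t).1.2 : ℕ) < s} : Set (Fin d)) =
      Nat.card {x : Σ p : Fin n × Fin n, Fin (C.1 p.1 p.2) // (x.1.1 : ℕ) < r ∧ (x.1.2 : ℕ) < s} :=
    Nat.card_congr (Equiv.subtypeEquiv e.symm fun t => Iff.rfl)
  rw [this, Nat.card_eq_fintype_card, Fintype.card_subtype, Finset.card_filter,
    Fintype.sum_sigma, Fintype.sum_prod_type]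
  refine Finset.sum_congr rfl fun k _ => Finset.sum_congr rfl fun l _ => ?_
  split_ifs <;> simp

end CoordinateFlags

/-- Every position occurs over every `ZMod p`, so the two polynomials agree at all odd primes. -/
theorem IsCountingPolynomial.unique {n d : ℕ} {A B C : Theta n d} {P Q : ℤ[X]}
    (hP : IsCountingPolynomial A B C P) (hQ : IsCountingPolynomial A B C Q) : P = Q := by
  refine Polynomial.eq_of_infinite_eval_eq P Q ?_
  have hinf : {p : ℕ | p.Prime ∧ 2 < p}.Infinite := by
    refine Set.infinite_of_forall_exists_gt fun m => ?_
    obtain ⟨p, hp, hpp⟩ := Nat.exists_infinite_primes (m + 3)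
    exact ⟨p, ⟨hpp, by omega⟩, by omega⟩
  refine (hinf.image (f := fun p : ℕ => (p : ℤ)) Nat.cast_injective.injOn).mono ?_
  rintro _ ⟨p, ⟨hp, h2⟩, rfl⟩
  have : Fact p.Prime := ⟨hp⟩
  obtain ⟨V, W, hVW⟩ := exists_relPos_eq (ZMod p) C
  have hchar : ringChar (ZMod p) ≠ 2 := by
    rw [ZMod.ringChar_zmod_n]
    omega
  have h1 := hP (ZMod p) hchar V W hVW
  have h2 := hQ (ZMod p) hchar V W hVW
  rw [ZMod.card] at h1 h2
  exact h1.symm.trans h2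

/-- The coefficient of the split term in a product of two steps. -/
def splitPoly {n : ℕ} (i a j b : Fin n) : ℤ[X] :=
  if i = j ∧ a = b ∧ i < a then Polynomial.X + 1
  else if i ≤ j ∧ j < a ∧ a ≤ b then Polynomial.X else 1

/-- The coefficient of the term of a nonsplit extension in a product of two steps. -/
def nonsplitPoly {n : ℕ} (a j : Fin n) : ℤ[X] := if j < a then Polynomial.X - 1 else 1

open Classical in
/-- The coefficient of `e_C` in a product of two steps. -/
def stepPoly {n : ℕ} (i a j b : Fin n) (ν : Fin n → ℕ) (C : Matrix (Fin n) (Fin n) ℕ) : ℤ[X] :=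
  if C = quad i a j b ν then splitPoly i a j b
  else if (i < j ∧ j ≤ a ∧ a < b) ∧ C = quad i b j a ν then nonsplitPoly a j
  else 0

theorem isCountingPolynomial_stepPoly {n d : ℕ} {i a j b : Fin n} (hia : i ≤ a) (hjb : j ≤ b)
    (ν : Fin n → ℕ) {A B : Theta n d} (hA : A.1 = quad i a j j ν) (hB : B.1 = quad j b a a ν)
    (C : Theta n d) : IsCountingPolynomial A B C (stepPoly i a j b ν C.1) := by
  intro F _ _ _ V W hVW
  rw [hA, hB, card_midFlags_eq V W hia hjb ν, ← hVW, stepPoly, ← Nat.card_eq_fintype_card]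
  -- The count `q - 1` is a truncated difference in `ℕ`; its cast to `ℤ` needs `1 ≤ q`.
  have : 1 ≤ Fintype.card F := Fintype.card_pos
  simp only [splitPoly, nonsplitPoly]
  split_ifs <;> simp [Nat.cast_sub this]

theorem existsUnique_isCountingPolynomial {n d : ℕ} {i a j b : Fin n} (hia : i ≤ a) (hjb : j ≤ b)
    (ν : Fin n → ℕ) {A B : Theta n d} (hA : A.1 = quad i a j j ν) (hB : B.1 = quad j b a a ν)
    (C : Theta n d) : ∃! P, IsCountingPolynomial A B C P :=
  ⟨_, isCountingPolynomial_stepPoly hia hjb ν hA hB C,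
    fun _ hP => hP.unique (isCountingPolynomial_stepPoly hia hjb ν hA hB C)⟩

theorem countingPolynomial_eq {n d : ℕ} {i a j b : Fin n} (hia : i ≤ a) (hjb : j ≤ b)
    (ν : Fin n → ℕ) {A B : Theta n d} (hA : A.1 = quad i a j j ν) (hB : B.1 = quad j b a a ν)
    (C : Theta n d) : countingPolynomial A B C = stepPoly i a j b ν C.1 := by
  have h := isCountingPolynomial_stepPoly hia hjb ν hA hB C
  have hex : ∃ P, IsCountingPolynomial A B C P := ⟨_, h⟩
  rw [countingPolynomial, dif_pos hex]
  exact hex.choose_spec.unique h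

/-! ### The exponents `d(A) - r(A)` -/

section Exponents

variable {n : ℕ}

/-- The bilinear form whose quadratic form is `d(A) - r(A)`. -/
def crossForm (X Y : Matrix (Fin n) (Fin n) ℕ) : ℤ :=
  ∑ i, ∑ j, ∑ k, ∑ l, if k ≤ i ∧ j < l then (X i j : ℤ) * (Y k l : ℤ) else 0

theorem orbitRowDim_eq (C : Matrix (Fin n) (Fin n) ℕ) :
    orbitRowDim C = ∑ i, ∑ j, ∑ k, ∑ l, if i < k then (C i j : ℤ) * (C k l : ℤ) else 0 := by
  rw [orbitRowDim, orbitDim]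
  refine Finset.sum_congr rfl fun i _ => ?_
  rw [Finset.sum_eq_single i]
  · rw [Finset.sum_comm (s := Finset.univ) (t := Finset.univ)
      (f := fun j k => ∑ l, if i < k then (C i j : ℤ) * (C k l : ℤ) else 0)]
    refine Finset.sum_congr rfl fun k _ => ?_
    rw [Finset.sum_eq_single k]
    · by_cases h : i < k
      · simp [h, Finset.sum_mul_sum]
      · simp [h]
    · intro l _ hl
      simp [Matrix.diagonal_apply_ne _ hl.symm]
    · simp
  · intro j _ hj
    simp [Matrix.diagonal_apply_ne _ hj.symm]
  · simp

theorem orbitDim_sub_orbitRowDim (C : Matrix (Fin n) (Fin n) ℕ) :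
    orbitDim C - orbitRowDim C = crossForm C C := by
  rw [orbitRowDim_eq, orbitDim, crossForm]
  simp only [← Finset.sum_sub_distrib]
  refine Finset.sum_congr rfl fun i _ => Finset.sum_congr rfl fun j _ =>
    Finset.sum_congr rfl fun k _ => Finset.sum_congr rfl fun l _ => ?_
  by_cases h1 : i < k
  · simp [h1, h1.not_ge]
  · simp [h1, not_lt.1 h1]

theorem crossForm_add_left (X X' Y : Matrix (Fin n) (Fin n) ℕ) :
    crossForm (X + X') Y = crossForm X Y + crossForm X' Y := by
  simp only [crossForm, ← Finset.sum_add_distrib]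
  refine Finset.sum_congr rfl fun i _ => Finset.sum_congr rfl fun j _ =>
    Finset.sum_congr rfl fun k _ => Finset.sum_congr rfl fun l _ => ?_
  split_ifs
  · simp [add_mul]
  · simp

theorem crossForm_add_right (X Y Y' : Matrix (Fin n) (Fin n) ℕ) :
    crossForm X (Y + Y') = crossForm X Y + crossForm X Y' := by
  simp only [crossForm, ← Finset.sum_add_distrib]
  refine Finset.sum_congr rfl fun i _ => Finset.sum_congr rfl fun j _ =>
    Finset.sum_congr rfl fun k _ => Finset.sum_congr rfl fun l _ => ?_
  split_ifs
  · simp [mul_add]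
  · simp

theorem crossForm_single_left (i a : Fin n) (Y : Matrix (Fin n) (Fin n) ℕ) :
    crossForm (Matrix.single i a 1) Y = ∑ k, ∑ l, if k ≤ i ∧ a < l then (Y k l : ℤ) else 0 := by
  rw [crossForm, Finset.sum_eq_single i, Finset.sum_eq_single a]
  · simp
  · intro l _ hl
    simp [hl.symm]
  · simp
  · intro k _ hk
    simp [hk.symm]
  · simp

theorem crossForm_single_single (i a j b : Fin n) :
    crossForm (Matrix.single i a 1) (Matrix.single j b 1) = if j ≤ i ∧ a < b then 1 else 0 := by
  rw [crossForm_single_left, Finset.sum_eq_single j, Finset.sum_eq_single b]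
  · simp
  · intro l _ hl
    simp [hl.symm]
  · simp
  · intro k _ hk
    simp [hk.symm]
  · simp

theorem crossForm_single_diagonal {i a : Fin n} (hia : i ≤ a) (ν : Fin n → ℕ) :
    crossForm (Matrix.single i a 1) (Matrix.diagonal ν) = 0 := by
  rw [crossForm_single_left]
  refine Finset.sum_eq_zero fun k _ => Finset.sum_eq_zero fun l _ => ?_
  by_cases hkl : k = l
  · subst hkl
    rw [if_neg]
    rintro ⟨h1, h2⟩
    exact absurd (h1.trans hia) h2.not_ge
  · simp [Matrix.diagonal_apply_ne _ hkl]

/-- The sum of the entries `ν k` with `i ≤ k < a`. -/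
def intervalSum (i a : Fin n) (ν : Fin n → ℕ) : ℤ :=
  ∑ k, if i ≤ k ∧ k < a then (ν k : ℤ) else 0

theorem crossForm_diagonal_left (ν : Fin n → ℕ) (Y : Matrix (Fin n) (Fin n) ℕ) :
    crossForm (Matrix.diagonal ν) Y =
      ∑ i, ∑ k, ∑ l, if k ≤ i ∧ i < l then (ν i : ℤ) * (Y k l : ℤ) else 0 := by
  refine Finset.sum_congr rfl fun i _ => ?_
  rw [Finset.sum_eq_single i]
  · simp
  · intro j _ hj
    simp [Matrix.diagonal_apply_ne _ hj.symm]
  · simp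

theorem crossForm_diagonal_single (i a : Fin n) (ν : Fin n → ℕ) :
    crossForm (Matrix.diagonal ν) (Matrix.single i a 1) = intervalSum i a ν := by
  rw [crossForm_diagonal_left]
  refine Finset.sum_congr rfl fun m _ => ?_
  rw [Finset.sum_eq_single i, Finset.sum_eq_single a]
  · simp
  · intro l _ hl
    simp [hl.symm]
  · simp
  · intro k _ hk
    simp [hk.symm]
  · simp

theorem crossForm_diagonal_diagonal (μ ν : Fin n → ℕ) :
    crossForm (Matrix.diagonal μ) (Matrix.diagonal ν) = 0 := by
  rw [crossForm_diagonal_left]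
  refine Finset.sum_eq_zero fun i _ => Finset.sum_eq_zero fun k _ =>
    Finset.sum_eq_zero fun l _ => ?_
  by_cases hkl : k = l
  · subst hkl
    rw [if_neg]
    rintro ⟨h1, h2⟩
    exact absurd h1 h2.not_ge
  · simp [Matrix.diagonal_apply_ne _ hkl]

theorem orbitDim_sub_quad {i a j b : Fin n} (hia : i ≤ a) (hjb : j ≤ b) (ν : Fin n → ℕ) :
    orbitDim (quad i a j b ν) - orbitRowDim (quad i a j b ν) =
      intervalSum i a ν + intervalSum j b ν + (if j ≤ i ∧ a < b then 1 else 0) +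
        if i ≤ j ∧ b < a then 1 else 0 := by
  rw [orbitDim_sub_orbitRowDim]
  simp only [quad, crossForm_add_left, crossForm_add_right, crossForm_single_single,
    crossForm_single_diagonal hia, crossForm_single_diagonal hjb, crossForm_diagonal_single,
    crossForm_diagonal_diagonal, lt_irrefl, and_false, if_false]
  ring

theorem orbitDim_sub_step {i a : Fin n} (hia : i ≤ a) (j : Fin n) (ν : Fin n → ℕ) :
    orbitDim (quad i a j j ν) - orbitRowDim (quad i a j j ν) =
      intervalSum i a ν + if i ≤ j ∧ j < a then 1 else 0 := by
  have h : intervalSum j j ν = 0 :=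
    Finset.sum_eq_zero fun k _ => if_neg fun h => absurd h.1 h.2.not_ge
  rw [orbitDim_sub_quad hia le_rfl, h, if_neg fun h => absurd (h.1.trans hia) h.2.not_ge]
  ring

/-- This makes the dependence on `ν` cancel in the nonsplit term as well. -/
theorem intervalSum_add {i j a b : Fin n} (hij : i ≤ j) (hja : j ≤ a) (hab : a ≤ b)
    (ν : Fin n → ℕ) :
    intervalSum i b ν + intervalSum j a ν = intervalSum i a ν + intervalSum j b ν := by
  simp only [intervalSum, ← Finset.sum_add_distrib]
  refine Finset.sum_congr rfl fun k _ => ?_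
  simp only [Fin.le_def, Fin.lt_def] at *
  split_ifs <;> omega

end Exponents

/-! ### Stabilization -/

section Stabilization

variable {n : ℕ}

theorem v_ne_zero : v ≠ 0 := RatFunc.X_ne_zero

theorem v_zpow_injective : Function.Injective fun p : ℕ => v ^ (-(p : ℤ)) := by
  intro p q h
  simp only [zpow_neg, zpow_natCast, inv_inj] at h
  have h1 : ∀ m : ℕ, v ^ m = algebraMap ℚ[X] Qv (Polynomial.X ^ m) := fun m => by
    rw [map_pow, RatFunc.algebraMap_X, v]
  rw [h1, h1] at h
  have h2 := RatFunc.algebraMap_injective ℚ h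
  simpa using congrArg Polynomial.natDegree h2

theorem shift_apply (p : ℕ) (Z : ThetaTilde n) (i j : Fin n) :
    shift p Z i j = Z.1 i j + if i = j then (p : ℤ) else 0 := by
  rw [shift, Matrix.add_apply, Matrix.smul_apply, Matrix.one_apply]
  split_ifs <;> simp

theorem shift_injective (p : ℕ) : Function.Injective (shift p : ThetaTilde n → _) :=
  fun _ _ h => Subtype.ext (add_right_cancel h)

theorem exists_theta_eq_shift {Z : ThetaTilde n} {p : ℕ} (hp : ∀ i, 0 ≤ Z.1 i i + p) :
    ∃ (d : ℕ) (C : Theta n d), C.1.map (fun m : ℕ => (m : ℤ)) = shift p Z := by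
  let M : Matrix (Fin n) (Fin n) ℕ := Matrix.of fun i j => (shift p Z i j).toNat
  refine ⟨∑ i, ∑ j, M i j, ⟨M, rfl⟩, ?_⟩
  ext i j
  have : 0 ≤ shift p Z i j := by
    by_cases hij : i = j
    · subst hij
      simpa [shift_apply] using hp i
    · simpa [shift_apply, hij] using Z.2 i j hij
  simpa [M] using this

theorem exists_forall_nonneg (f : Fin n → ℤ) : ∃ p₀ : ℕ, ∀ p, p₀ ≤ p → ∀ i, 0 ≤ f i + (p : ℤ) := by
  refine ⟨∑ i, (f i).natAbs, fun p hp i => ?_⟩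
  have := Finset.single_le_sum (f := fun i => (f i).natAbs) (fun _ _ => Nat.zero_le _)
    (Finset.mem_univ i)
  omega

theorem sum_smul_bracket_apply (G : ThetaTilde n →₀ Qv[X]) (Z : ThetaTilde n) (x : Qv) (p : ℕ)
    {d : ℕ} {C : Theta n d} (hC : C.1.map (fun m : ℕ => (m : ℤ)) = shift p Z) :
    (G.sum fun Z g => g.eval x • bracket d (shift p Z)) C =
      (G Z).eval x * v ^ (-(orbitDim C.1 - orbitRowDim C.1)) := by
  rw [Finsupp.sum, Finset.sum_apply, Finset.sum_eq_single Z]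
  · simp [bracket, hC]
  · intro Z' _ hZ'
    have : C.1.map (fun m : ℕ => (m : ℤ)) ≠ shift p Z' := fun h =>
      hZ' (shift_injective p (h.symm.trans hC))
    simp [bracket, this]
  · intro hZ
    simp [Finsupp.notMem_support_iff.1 hZ]

/-- For large `p` the matrix `Z + pI` lies in some `Θ_d`, and its coefficient there gives the value
of `G_Z` at `v ^ (-p)`. These points are infinitely many. -/
theorem IsStabilization.unique {A B : ThetaTilde n} {G G' : ThetaTilde n →₀ Qv[X]}
    (h : IsStabilization A B G) (h' : IsStabilization A B G') : G = G' := by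
  obtain ⟨p₁, h₁⟩ := h.2
  obtain ⟨p₂, h₂⟩ := h'.2
  ext1 Z
  obtain ⟨p₃, h₃⟩ := exists_forall_nonneg fun i => Z.1 i i
  refine Polynomial.eq_of_infinite_eval_eq _ _ ?_
  refine ((Set.Ici_infinite (max p₁ (max p₂ p₃))).image
    (f := fun p : ℕ => v ^ (-(p : ℤ))) v_zpow_injective.injOn).mono ?_
  rintro _ ⟨p, hp, rfl⟩
  simp only [Set.mem_Ici, max_le_iff] at hp
  obtain ⟨d, C, hC⟩ := exists_theta_eq_shift (h₃ p hp.2.2)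
  have e := congrFun ((h₁ p hp.1 d).symm.trans (h₂ p hp.2.1 d)) C
  rw [sum_smul_bracket_apply _ Z _ p hC, sum_smul_bracket_apply _ Z _ p hC] at e
  exact mul_right_cancel₀ (zpow_ne_zero _ v_ne_zero) e

/-- The matrix `E_{ia} + E_{jb} + diag ν` as an element of `Θ̃`. -/
def quadTilde (i a j b : Fin n) (ν : Fin n → ℤ) : ThetaTilde n :=
  ⟨quad i a j b ν, fun k l hkl => by
    rw [quad, Matrix.add_apply, Matrix.add_apply, Matrix.diagonal_apply_ne _ hkl, add_zero,
      Matrix.single_apply, Matrix.single_apply]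
    split_ifs <;> norm_num⟩

theorem ro_quadTilde (i a j b : Fin n) (ν : Fin n → ℤ) :
    ro (quadTilde i a j b ν) = Pi.single i 1 + Pi.single j 1 + ν := by
  funext k
  simp [ro, quadTilde, quad, Finset.sum_add_distrib, Matrix.single_apply, Matrix.diagonal_apply,
    Pi.single_apply, ite_and, eq_comm]

theorem co_quadTilde (i a j b : Fin n) (ν : Fin n → ℤ) :
    co (quadTilde i a j b ν) = Pi.single a 1 + Pi.single b 1 + ν := by
  funext k
  simp [co, quadTilde, quad, Finset.sum_add_distrib, Matrix.single_apply, Matrix.diagonal_apply,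
    Pi.single_apply, ite_and, eq_comm]

theorem shift_quadTilde (i a j b : Fin n) {ν : Fin n → ℤ} {p : ℕ} (hp : ∀ k, 0 ≤ ν k + (p : ℤ)) :
    shift p (quadTilde i a j b ν) =
      (quad i a j b fun k => (ν k + p).toNat).map (fun m : ℕ => (m : ℤ)) := by
  ext k l
  by_cases hkl : k = l
  · subst hkl
    have := hp k
    simp [shift_apply, quadTilde, quad, Matrix.single_apply, this, add_assoc]
  · simp [shift_apply, quadTilde, quad, Matrix.single_apply, hkl]

theorem sum_quad (i a j b : Fin n) (ν : Fin n → ℕ) :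
    ∑ k, ∑ l, quad i a j b ν k l = 2 + ∑ k, ν k := by
  simp [quad, Finset.sum_add_distrib, Matrix.single_apply, Matrix.diagonal_apply, ite_and]

theorem map_natCast_injective :
    Function.Injective fun M : Matrix (Fin n) (Fin n) ℕ => M.map (fun m : ℕ => (m : ℤ)) :=
  Matrix.map_injective Nat.cast_injective

/-- The coefficient of the split term in the stabilized product of two steps. -/
def splitCoeff (i a j b : Fin n) : Qv :=
  v ^ (-(if i ≤ j ∧ j < a then 1 else 0) - (if j ≤ a ∧ a < b then 1 else 0) +
    (if j ≤ i ∧ a < b then 1 else 0) + (if i ≤ j ∧ b < a then 1 else 0) : ℤ) *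
      Polynomial.aeval (v ^ 2) (splitPoly i a j b)

/-- The coefficient of the nonsplit term in the stabilized product of two steps. -/
def nonsplitCoeff (i a j b : Fin n) : Qv :=
  if i < j ∧ j ≤ a ∧ a < b then
    v ^ (-(if j < a then 1 else 0) : ℤ) * Polynomial.aeval (v ^ 2) (nonsplitPoly a j)
  else 0

/-- The stabilizing family for a product of two steps; it does not depend on `v'`. -/
def stepFamily (i a j b : Fin n) (ν : Fin n → ℤ) : ThetaTilde n →₀ Qv[X] :=
  Finsupp.single (quadTilde i a j b ν) (Polynomial.C (splitCoeff i a j b)) +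
    Finsupp.single (quadTilde i b j a ν) (Polynomial.C (nonsplitCoeff i a j b))

theorem schurMul_bracket {d : ℕ} (A B : Theta n d) (C : Theta n d) :
    schurMul (bracket d (A.1.map fun m : ℕ => (m : ℤ))) (bracket d (B.1.map fun m : ℕ => (m : ℤ))) C
      = v ^ (-(orbitDim A.1 - orbitRowDim A.1)) * v ^ (-(orbitDim B.1 - orbitRowDim B.1)) *
        Polynomial.aeval (v ^ 2) (countingPolynomial A B C) := by
  rw [schurMul, Finset.sum_eq_single A, Finset.sum_eq_single B]
  · simp [bracket]
  · intro B' _ hB'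
    have : B'.1.map (fun m : ℕ => (m : ℤ)) ≠ B.1.map (fun m : ℕ => (m : ℤ)) := fun h =>
      hB' (Subtype.ext (map_natCast_injective h))
    simp [bracket, this]
  · simp
  · intro A' _ hA'
    have : A'.1.map (fun m : ℕ => (m : ℤ)) ≠ A.1.map (fun m : ℕ => (m : ℤ)) := fun h =>
      hA' (Subtype.ext (map_natCast_injective h))
    simp [bracket, this]
  · simp

theorem bracket_eq_zero {d : ℕ} {M : Matrix (Fin n) (Fin n) ℕ} (h : ∑ i, ∑ j, M i j ≠ d) :
    bracket d (M.map fun m : ℕ => (m : ℤ)) = 0 := by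
  funext C
  rw [bracket, if_neg fun hC => h ?_]
  · rfl
  · rw [← map_natCast_injective hC]
    exact C.2

theorem schurMul_zero_left {d : ℕ} (g : Schur n d) : schurMul 0 g = 0 := by
  funext C
  simp [schurMul]

theorem stepFamily_sum (i a j b : Fin n) (ν : Fin n → ℤ) (d p : ℕ) (x : Qv) :
    ((stepFamily i a j b ν).sum fun Z g => g.eval x • bracket d (shift p Z)) =
      splitCoeff i a j b • bracket d (shift p (quadTilde i a j b ν)) +
        nonsplitCoeff i a j b • bracket d (shift p (quadTilde i b j a ν)) := by
  rw [stepFamily, Finsupp.sum_add_index', Finsupp.sum_single_index, Finsupp.sum_single_index]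
  · simp
  · simp
  · simp
  · simp
  · intro Z g g'
    rw [Polynomial.eval_add, add_smul]

theorem quad_ne_quad {R : Type*} [Semiring R] [Nontrivial R] [IsRightCancelAdd R]
    {i a j b : Fin n} (hij : i ≠ j)
    (hab : a ≠ b) (ν : Fin n → R) : quad i a j b ν ≠ quad i b j a ν := by
  intro h
  have h1 := add_right_cancel (congrFun (congrFun h i) a)
  simp [hij.symm, hab.symm] at h1

/-- The sums `intervalSum i a` and `intervalSum j b` contributed by the two factors are those of the
resulting term, so the exponents reduce to Kronecker symbols that do not involve `p`. -/
theorem isStabilization_stepFamily {i a j b : Fin n} (hia : i ≤ a) (hjb : j ≤ b)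
    (ν : Fin n → ℤ) :
    IsStabilization (quadTilde i a j j ν) (quadTilde j b a a ν) (stepFamily i a j b ν) := by
  classical
  refine ⟨fun Z hZ => ?_, ?_⟩
  · have h1 := Finsupp.support_add hZ
    rw [Finset.mem_union] at h1
    simp only [ro_quadTilde, co_quadTilde]
    rcases h1 with h1 | h1
    · rw [Finset.mem_singleton.1 (Finsupp.support_single_subset h1), ro_quadTilde, co_quadTilde]
      exact ⟨rfl, by rw [add_comm (Pi.single a 1)]⟩
    · rw [Finset.mem_singleton.1 (Finsupp.support_single_subset h1), ro_quadTilde, co_quadTilde]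
      exact ⟨rfl, rfl⟩
  obtain ⟨p₀, h₀⟩ := exists_forall_nonneg ν
  refine ⟨p₀, fun p hp d => ?_⟩
  rw [stepFamily_sum]
  simp only [shift_quadTilde _ _ _ _ (h₀ p hp)]
  set μ : Fin n → ℕ := fun k => (ν k + p).toNat
  -- For any other `d` all brackets vanish by convention and both sides are zero.
  by_cases hd : 2 + ∑ k, μ k = d
  swap
  · rw [bracket_eq_zero (by rwa [sum_quad]), bracket_eq_zero (by rwa [sum_quad]),
      bracket_eq_zero (by rwa [sum_quad]), bracket_eq_zero (by rwa [sum_quad]),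
      schurMul_zero_left, smul_zero, smul_zero, add_zero]
  let T : Fin n → Fin n → Fin n → Fin n → Theta n d := fun i a j b =>
    ⟨quad i a j b μ, by rw [sum_quad, hd]⟩
  funext C
  have hmul := schurMul_bracket (T i a j j) (T j b a a) C
  rw [countingPolynomial_eq hia hjb μ rfl rfl] at hmul
  refine hmul.trans ?_
  have hA := orbitDim_sub_step hia j μ
  have hB := orbitDim_sub_step hjb a μ
  have hZ := orbitDim_sub_quad hia hjb μ
  have hbr : ∀ M : Matrix (Fin n) (Fin n) ℕ, bracket d (M.map fun m : ℕ => (m : ℤ)) C =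
      if C.1 = M then v ^ (-(orbitDim C.1 - orbitRowDim C.1)) else 0 := fun M =>
    if_congr map_natCast_injective.eq_iff rfl rfl
  rw [Pi.add_apply, Pi.smul_apply, Pi.smul_apply, hbr, hbr, stepPoly]
  change v ^ (-(orbitDim (quad i a j j μ) - orbitRowDim (quad i a j j μ))) *
    v ^ (-(orbitDim (quad j b a a μ) - orbitRowDim (quad j b a a μ))) * _ = _
  rw [hA, hB, ← zpow_add₀ v_ne_zero]
  simp only [smul_eq_mul]
  by_cases h1 : C.1 = quad i a j b μ
  · rw [if_pos h1, if_pos h1, h1, hZ]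
    -- The two matrices can coincide when `i = j` or `a = b`, but then the nonsplit coefficient is
    -- zero.
    have h2 : nonsplitCoeff i a j b * (if quad i a j b μ = quad i b j a μ then
        v ^ (-((intervalSum i a μ + intervalSum j b μ + if j ≤ i ∧ a < b then 1 else 0) +
          if i ≤ j ∧ b < a then 1 else 0)) else 0) = 0 := by
      by_cases hlt : i < j ∧ j ≤ a ∧ a < b
      · rw [if_neg (quad_ne_quad hlt.1.ne hlt.2.2.ne μ), mul_zero]
      · rw [nonsplitCoeff, if_neg hlt, zero_mul]
    rw [h2, add_zero, splitCoeff, mul_right_comm, ← zpow_add₀ v_ne_zero]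
    simp only [Fin.le_def, Fin.lt_def] at hia hjb ⊢
    congr 2
    split_ifs <;> omega
  rw [if_neg h1, if_neg h1, mul_zero, zero_add]
  by_cases hlt : i < j ∧ j ≤ a ∧ a < b
  swap
  · rw [nonsplitCoeff, if_neg hlt, zero_mul, if_neg (not_and_of_not_left _ hlt), map_zero, mul_zero]
  by_cases h2 : C.1 = quad i b j a μ
  · have hZ' := orbitDim_sub_quad (hia.trans hlt.2.2.le) hlt.2.1 μ
    have hI := intervalSum_add hlt.1.le hlt.2.1 hlt.2.2.le μ
    rw [if_pos (And.intro hlt h2), if_pos h2, h2, hZ', nonsplitCoeff, if_pos hlt, mul_right_comm,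
      ← zpow_add₀ v_ne_zero, hI]
    simp only [Fin.le_def, Fin.lt_def] at hlt ⊢
    congr 2
    split_ifs <;> omega
  · rw [if_neg (not_and_of_not_right _ h2), if_neg h2, map_zero, mul_zero, mul_zero]

theorem kMul_quadTilde {i a j b : Fin n} (hia : i ≤ a) (hjb : j ≤ b) (ν : Fin n → ℤ) :
    kMul (quadTilde i a j j ν) (quadTilde j b a a ν) =
      Finsupp.single (quadTilde i a j b ν) (splitCoeff i a j b) +
        Finsupp.single (quadTilde i b j a ν) (nonsplitCoeff i a j b) := by
  have hst := isStabilization_stepFamily hia hjb ν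
  have h : co (quadTilde i a j j ν) = ro (quadTilde j b a a ν) ∧
      ∃ G, IsStabilization (quadTilde i a j j ν) (quadTilde j b a a ν) G := by
    refine ⟨?_, _, hst⟩
    rw [co_quadTilde, ro_quadTilde, add_comm (Pi.single a 1)]
  rw [kMul, dif_pos h, h.2.choose_spec.unique hst, stepFamily]
  rw [Finsupp.mapRange_add fun _ _ => Polynomial.eval_add, Finsupp.mapRange_single,
    Finsupp.mapRange_single, Polynomial.eval_C, Polynomial.eval_C]

theorem stableProductDefined_quadTilde {i a j b : Fin n} (hia : i ≤ a) (hjb : j ≤ b)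
    (ν : Fin n → ℤ) : StableProductDefined (quadTilde i a j j ν) (quadTilde j b a a ν) := by
  refine ⟨?_, _, isStabilization_stepFamily hia hjb ν,
    fun _ hG => hG.unique (isStabilization_stepFamily hia hjb ν)⟩
  obtain ⟨p₀, h₀⟩ := exists_forall_nonneg ν
  refine ⟨p₀, fun p hp d A' B' C hA hB => ?_⟩
  rw [shift_quadTilde _ _ _ _ (h₀ p hp)] at hA hB
  exact existsUnique_isCountingPolynomial hia hjb _ (map_natCast_injective hA)
    (map_natCast_injective hB) C

end Stabilization

/-! ### The relation between the scalar coefficients -/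

section Scalars

variable {K : Type*} [Field K]

/-- The coefficient of `t̄_{ia}` at a matrix with `i`-th diagonal entry `0`. -/
def stepScalar (v : K) (i a : ℕ) : K := if i < a then v - v⁻¹ else 1

/-- The exponent of `v` in the split term of `t̄_{ia} t̄_{jb}`. -/
def splitExp (i a j b : ℕ) : ℤ :=
  (if i = j then 1 else 0) + (if i = a then 1 else 0) + (if j = a then 1 else 0) +
    (if j = b then 1 else 0) - (if i ≤ j ∧ j < a then 1 else 0) -
    (if j ≤ a ∧ a < b then 1 else 0) + (if j ≤ i ∧ a < b then 1 else 0) +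
    (if i ≤ j ∧ b < a then 1 else 0)

/-- The value of `t̄_{ia} t̄_{jb}` at `C`, up to a power of `v`, when `x` and `y` are the indicators
of the split and the nonsplit matrix at `C`. -/
def stepVal (v : K) (i a j b : ℕ) (x y : K) : K :=
  if i ≤ a ∧ j ≤ b then
    stepScalar v i a * stepScalar v j b *
      (v ^ splitExp i a j b * (if i = j ∧ a = b ∧ i < a then v ^ 2 + 1
        else if i ≤ j ∧ j < a ∧ a ≤ b then v ^ 2 else 1) * x +
      (if i < j ∧ j ≤ a ∧ a < b then (if j < a then v - v⁻¹ else v) else 0) * y)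
  else 0

-- The six pairwise comparisons fix the order type of `i, j, a, b`. Inconsistent combinations are
-- discarded, and each remaining one is an identity of Laurent polynomials in `v`, linear in `x` and
-- `y`. For `i = j` or `a = b` the two matrices coincide, hence the hypothesis `hxy`.
set_option maxHeartbeats 4000000 in
theorem stepVal_relation {v : K} (hv : v ≠ 0) (i a j b : ℕ) {x y : K}
    (hxy : i = j ∨ a = b → x = y) :
    v ^ (-(if i = j then 1 else 0) : ℤ) * stepVal v i a j b x y -
        v ^ (-(if a = b then 1 else 0) : ℤ) * stepVal v j b i a x y =
      (v⁻¹ - v) * ((if b < a then 1 else 0) - (if i < j then 1 else 0)) *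
        stepVal v j a i b y x := by
  rcases lt_trichotomy i j with hij | hij | hij <;>
  rcases lt_trichotomy a b with hab | hab | hab <;>
  rcases lt_trichotomy i a with hia | hia | hia <;>
  rcases lt_trichotomy j b with hjb | hjb | hjb <;>
  rcases lt_trichotomy i b with hib | hib | hib <;>
  rcases lt_trichotomy j a with hja | hja | hja <;>
  first
  | (exfalso; omega)
  | (try have hxy' : x = y := hxy (by omega)
     try subst hxy'
     simp (disch := omega) only [stepVal, stepScalar, splitExp, if_pos, if_neg]
     try norm_num
     try field_simp
     try ring)

end Scalars

/-! ### Products of the generators -/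

section Generators

variable {n : ℕ}

theorem hatElt_apply_single (A : ThetaZero n) (lam : Fin n → ℤ) (i : Fin n) :
    (hatElt A (Pi.single i 1)).1 (addDiag A lam) = v ^ ((addDiag A lam).1 i i) := by
  refine (if_pos ⟨lam, rfl⟩).trans ?_
  simp [Pi.single_apply]

theorem exists_of_hatElt_ne_zero {A : ThetaZero n} {j : Fin n → ℤ} {M : ThetaTilde n}
    (h : (hatElt A j).1 M ≠ 0) : ∃ lam, M = addDiag A lam := by
  by_contra hne
  exact h (if_neg hne)

theorem quadTilde_eq_addDiag_unitMat {i a : Fin n} (hia : i < a) (j : Fin n) (ν : Fin n → ℤ) :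
    quadTilde i a j j ν = addDiag (unitMat i a hia) (Pi.single j 1 + ν) := by
  refine Subtype.ext ?_
  change Matrix.single i a 1 + Matrix.single j j 1 + Matrix.diagonal ν =
    Matrix.single i a 1 + Matrix.diagonal (Pi.single j 1 + ν)
  rw [add_assoc, ← Matrix.diagonal_single, Matrix.diagonal_add]
  rfl

theorem quadTilde_eq_addDiag_zeroMat (i j : Fin n) (ν : Fin n → ℤ) :
    quadTilde i i j j ν = addDiag (zeroMat n) (Pi.single i 1 + Pi.single j 1 + ν) := by
  refine Subtype.ext ?_
  change Matrix.single i i 1 + Matrix.single j j 1 + Matrix.diagonal ν =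
    0 + Matrix.diagonal (Pi.single i 1 + Pi.single j 1 + ν)
  rw [zero_add, ← Matrix.diagonal_single, ← Matrix.diagonal_single, Matrix.diagonal_add,
    Matrix.diagonal_add]
  rfl

theorem quadTilde_diag {i a : Fin n} (j : Fin n) (ν : Fin n → ℤ) :
    (quadTilde i a j j ν).1 i i = ν i + (if i = j then 1 else 0) + if i = a then 1 else 0 := by
  simp only [quadTilde, quad, Matrix.add_apply, Matrix.single_apply, Matrix.diagonal_apply_eq,
    and_self, true_and, eq_comm (b := i)]
  ring

theorem tbar_quadTilde {i a : Fin n} (hia : i ≤ a) (j : Fin n) (ν : Fin n → ℤ) :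
    (tbar i a).1 (quadTilde i a j j ν) =
      stepScalar v i a * v ^ (ν i + (if i = j then 1 else 0) + if i = a then 1 else 0) := by
  rw [← quadTilde_diag (a := a)]
  rcases hia.lt_or_eq with h | rfl
  · rw [tbar, dif_pos h, quadTilde_eq_addDiag_unitMat h, stepScalar, if_pos (Fin.lt_def.1 h)]
    change -(v⁻¹ - v) * (hatElt _ _).1 _ = _
    rw [hatElt_apply_single]
    ring
  · rw [tbar, dif_neg (lt_irrefl _), if_pos rfl, quadTilde_eq_addDiag_zeroMat,
      hatElt_apply_single, stepScalar, if_neg (lt_irrefl _), one_mul]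

/-- The index `j` is free because the diagonal of a term of `t̄_{ia}` is an arbitrary integer
vector, from which `E_{jj}` may be split off. -/
theorem eq_quadTilde_of_tbar_ne_zero {i a : Fin n} {M : ThetaTilde n} (h : (tbar i a).1 M ≠ 0)
    (j : Fin n) : i ≤ a ∧ M = quadTilde i a j j (ro M - Pi.single i 1 - Pi.single j 1) := by
  suffices hs : i ≤ a ∧ ∃ μ, M = quadTilde i a j j μ by
    obtain ⟨hia, μ, rfl⟩ := hs
    refine ⟨hia, congrArg _ ?_⟩
    rw [ro_quadTilde]
    abel
  unfold tbar at h
  split_ifs at h with h1 h2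
  · have h3 : (hatElt (unitMat i a h1) (Pi.single i 1)).1 M ≠ 0 := fun h0 => h (by
      change _ * (hatElt (unitMat i a h1) (Pi.single i 1)).1 M = 0
      rw [h0, mul_zero])
    obtain ⟨lam, rfl⟩ := exists_of_hatElt_ne_zero h3
    refine ⟨h1.le, lam - Pi.single j 1, ?_⟩
    rw [quadTilde_eq_addDiag_unitMat h1]
    exact congrArg _ (by abel)
  · subst h2
    obtain ⟨lam, rfl⟩ := exists_of_hatElt_ne_zero h
    refine ⟨le_rfl, lam - Pi.single i 1 - Pi.single j 1, ?_⟩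
    rw [quadTilde_eq_addDiag_zeroMat]
    exact congrArg _ (by abel)
  · exact absurd rfl h

theorem eq_quadTilde_pair {i a j b : Fin n} {A B : ThetaTilde n} (hA : (tbar i a).1 A ≠ 0)
    (hB : (tbar j b).1 B ≠ 0) (hAB : co A = ro B) :
    i ≤ a ∧ j ≤ b ∧ A = quadTilde i a j j (ro A - Pi.single i 1 - Pi.single j 1) ∧
      B = quadTilde j b a a (ro A - Pi.single i 1 - Pi.single j 1) := by
  obtain ⟨hia, h1⟩ := eq_quadTilde_of_tbar_ne_zero hA j
  obtain ⟨hjb, h2⟩ := eq_quadTilde_of_tbar_ne_zero hB a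
  refine ⟨hia, hjb, h1, ?_⟩
  rw [h2, ← hAB]
  refine congrArg _ ?_
  conv_lhs => rw [h1, co_quadTilde]
  abel

theorem tbar_of_not_le {i a : Fin n} (h : ¬ i ≤ a) : tbar i a = 0 := by
  rw [tbar, dif_neg fun h' => h h'.le, if_neg fun h' => h h'.le]

theorem split_scalar (i a j b : Fin n) (s t : ℤ) :
    v ^ (s + (if i = j then 1 else 0) + if i = a then 1 else 0) *
      v ^ (t + (if j = a then 1 else 0) + if j = b then 1 else 0) * splitCoeff i a j b =
    v ^ (s + t) * (v ^ splitExp i a j b * (if (i : ℕ) = j ∧ (a : ℕ) = b ∧ (i : ℕ) < a then v ^ 2 + 1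
        else if (i : ℕ) ≤ j ∧ (j : ℕ) < a ∧ (a : ℕ) ≤ b then v ^ 2 else 1)) := by
  have hp : Polynomial.aeval (v ^ 2) (splitPoly i a j b) =
      if (i : ℕ) = j ∧ (a : ℕ) = b ∧ (i : ℕ) < a then v ^ 2 + 1
        else if (i : ℕ) ≤ j ∧ (j : ℕ) < a ∧ (a : ℕ) ≤ b then v ^ 2 else 1 := by
    simp only [splitPoly, Fin.ext_iff, Fin.lt_def, Fin.le_def]
    split_ifs <;> simp
  rw [splitCoeff, hp, ← mul_assoc, ← mul_assoc, ← zpow_add₀ v_ne_zero, ← zpow_add₀ v_ne_zero,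
    ← zpow_add₀ v_ne_zero]
  simp only [splitExp, Fin.ext_iff, Fin.lt_def, Fin.le_def]
  congr 2
  ring

/-- For `j < a` the factor is `v⁻¹ (v² - 1) = v - v⁻¹`. For `j = a` the extra `v` comes from the
diagonal entry of the second factor. -/
theorem nonsplit_scalar (i a j b : Fin n) (s t : ℤ) :
    v ^ (s + (if i = j then 1 else 0) + if i = a then 1 else 0) *
      v ^ (t + (if j = a then 1 else 0) + if j = b then 1 else 0) * nonsplitCoeff i a j b =
    v ^ (s + t) * (if (i : ℕ) < j ∧ (j : ℕ) ≤ a ∧ (a : ℕ) < b then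
      (if (j : ℕ) < a then v - v⁻¹ else v) else 0) := by
  have hv := v_ne_zero
  by_cases h : i < j ∧ j ≤ a ∧ a < b
  swap
  · have h' : ¬((i : ℕ) < j ∧ (j : ℕ) ≤ a ∧ (a : ℕ) < b) := by simpa using h
    rw [nonsplitCoeff, if_neg h, if_neg h', mul_zero, mul_zero]
  have h1 : i ≠ j := h.1.ne
  have h2 : i ≠ a := (h.1.trans_le h.2.1).ne
  have h3 : j ≠ b := (h.2.1.trans_lt h.2.2).ne
  have h' : (i : ℕ) < j ∧ (j : ℕ) ≤ a ∧ (a : ℕ) < b := by simpa using h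
  rw [nonsplitCoeff, if_pos h, if_pos h', if_neg h1, if_neg h2, if_neg h3,
    nonsplitPoly]
  rcases h.2.1.lt_or_eq with hja | hja
  · rw [if_neg hja.ne, if_pos hja, if_pos hja, if_pos (Fin.lt_def.1 hja), map_sub, map_one,
      Polynomial.aeval_X, add_zero, add_zero, add_zero, add_zero, ← zpow_add₀ hv]
    congr 1
    rw [zpow_neg, zpow_one]
    field_simp
  · subst hja
    rw [if_pos rfl, if_neg (lt_irrefl _), if_neg (lt_irrefl _), if_neg (lt_irrefl _), map_one,
      neg_zero, zpow_zero, mul_one, mul_one, add_zero, add_zero, add_zero, ← zpow_add₀ hv,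
      ← add_assoc, zpow_add_one₀ hv]

open Classical in
-- The row sums of `C` are those of the left factor and so fix `ν`. By `eq_quadTilde_pair` the sum
-- over all pairs has then at most one nonzero term.
theorem tbar_mul_tbar_apply (i a j b : Fin n) (C : ThetaTilde n) {ν : Fin n → ℤ}
    (hν : ν = ro C - Pi.single i 1 - Pi.single j 1) :
    (tbar i a * tbar j b).1 C = v ^ (ν i + ν j) * stepVal v i a j b
      (if C = quadTilde i a j b ν then 1 else 0) (if C = quadTilde i b j a ν then 1 else 0) := by
  by_cases hle : i ≤ a ∧ j ≤ b
  swap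
  · rw [stepVal, if_neg (by simpa using hle), mul_zero]
    rcases not_and_or.1 hle with h | h
    · rw [tbar_of_not_le h, zero_mul]
      rfl
    · rw [tbar_of_not_le h, mul_zero]
      rfl
  obtain ⟨hia, hjb⟩ := hle
  rw [Khat_mul_apply, finsum_eq_single _ (quadTilde i a j j ν, quadTilde j b a a ν)]
  · rw [tbar_quadTilde hia, tbar_quadTilde hjb, kMul_quadTilde hia hjb, Finsupp.add_apply,
      Finsupp.single_apply, Finsupp.single_apply, stepVal,
      if_pos (And.intro (Fin.le_def.1 hia) (Fin.le_def.1 hjb))]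
    have h1 := split_scalar i a j b (ν i) (ν j)
    have h2 := nonsplit_scalar i a j b (ν i) (ν j)
    have e : ∀ (D : ThetaTilde n) (c : Qv), (if D = C then c else 0) = c * if C = D then 1 else 0 :=
      fun D c => by rw [mul_ite, mul_one, mul_zero]; exact if_congr eq_comm rfl rfl
    rw [e, e]
    linear_combination (stepScalar v i a * stepScalar v j b *
      if C = quadTilde i a j b ν then 1 else 0) * h1 + (stepScalar v i a * stepScalar v j b *
      if C = quadTilde i b j a ν then 1 else 0) * h2
  · rintro ⟨A, B⟩ hne
    by_contra h0
    obtain ⟨h1, h2⟩ := mul_ne_zero_iff.1 h0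
    obtain ⟨hA, hB⟩ := mul_ne_zero_iff.1 h1
    obtain ⟨h3, h4, h5⟩ := kMul_ne_zero h2
    obtain ⟨-, -, h6, h7⟩ := eq_quadTilde_pair hA hB h3
    rw [← h4, ← hν] at h6 h7
    exact hne (Prod.ext h6 h7)

theorem quadTilde_comm (i a j b : Fin n) (ν : Fin n → ℤ) :
    quadTilde i a j b ν = quadTilde j b i a ν :=
  Subtype.ext (by simp only [quadTilde, quad, add_comm (Matrix.single i a (1 : ℤ))])

end Generators

end BLM

end

theorem mainTheorem2 (n : ℕ) :
    (∀ (i j a b : Fin n) (A B : BLM.ThetaTilde n),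
      (BLM.tbar i a).1 A ≠ 0 → (BLM.tbar j b).1 B ≠ 0 → BLM.co A = BLM.ro B →
        BLM.StableProductDefined A B) ∧
    ∀ i j a b : Fin n,
      (BLM.v ^ (-BLM.delta (i = j))) • (BLM.tU i a * BLM.tU j b)
        - (BLM.v ^ (-BLM.delta (a = b))) • (BLM.tU j b * BLM.tU i a)
      = ((BLM.v⁻¹ - BLM.v) * ((BLM.delta (b < a) - BLM.delta (i < j) : ℤ) : BLM.Qv)) •
          (BLM.tU j a * BLM.tU i b) := by
  classical
  refine ⟨fun i j a b A B hA hB hAB => ?_, fun i j a b => ?_⟩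
  · obtain ⟨hia, hjb, h1, h2⟩ := BLM.eq_quadTilde_pair hA hB hAB
    generalize BLM.ro A - Pi.single i 1 - Pi.single j 1 = ν at h1 h2
    rw [h1, h2]
    exact BLM.stableProductDefined_quadTilde hia hjb _
  · refine Subtype.ext (Subtype.ext (funext fun C => ?_))
    change BLM.v ^ (-BLM.delta (i = j)) * (BLM.tbar i a * BLM.tbar j b).1 C -
        BLM.v ^ (-BLM.delta (a = b)) * (BLM.tbar j b * BLM.tbar i a).1 C =
      ((BLM.v⁻¹ - BLM.v) * ((BLM.delta (b < a) - BLM.delta (i < j) : ℤ) : BLM.Qv)) *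
        (BLM.tbar j a * BLM.tbar i b).1 C
    set ν : Fin n → ℤ := BLM.ro C - Pi.single i 1 - Pi.single j 1 with hν
    -- The same `ν` serves all three products, since it depends on the row indices `i` and `j` only
    -- up to order.
    have hν' : ν = BLM.ro C - Pi.single j 1 - Pi.single i 1 := sub_right_comm _ _ _
    rw [BLM.tbar_mul_tbar_apply i a j b C hν, BLM.tbar_mul_tbar_apply j b i a C hν',
      BLM.tbar_mul_tbar_apply j a i b C hν', BLM.quadTilde_comm j b i a,
      BLM.quadTilde_comm j a i b, add_comm (ν j)]
    have key := BLM.stepVal_relation BLM.v_ne_zero i a j b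
      (x := if C = BLM.quadTilde i a j b ν then (1 : BLM.Qv) else 0)
      (y := if C = BLM.quadTilde i b j a ν then (1 : BLM.Qv) else 0) (by
        rintro (h | h)
        · obtain rfl := Fin.ext h
          rw [BLM.quadTilde_comm]
        · obtain rfl := Fin.ext h
          rfl)
    simp only [BLM.delta, Fin.ext_iff, Fin.lt_def] at key ⊢
    push_cast
    linear_combination BLM.v ^ (ν i + ν j) * key
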